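/- **Proposition 5.1.** Let $G$ be a (real, finite-dimensional) Lie group with Lie algebra $\mathfrak g$ that is unimodular in the sense that $\operatorname{tr}(\operatorname{ad}_{\mathfrak g}X)=0$ for all $X\in\mathfrak g$. Let $H$ be a closed subgroup of $G$ whose Lie algebra $\mathfrak h$ is reductive in $\mathfrak g$ (i.e. the adjoint representation of $\mathfrak h$ on $\mathfrak g$ is semisimple), let $N=\dim(\mathfrak g/\mathfrak h)$ be the codimension of $H$ in $G$, and let $K_H$ be a maximal compact subgroup of $H$, with Lie algebra $\mathfrak k_H\subset\mathfrak h$. For a subalgebra $\mathfrak l\subset\mathfrak g$ let $H^p(\mathfrak g,\mathfrak l;\mathbb R)$ denote relative Lie algebra cohomology, i.e. the cohomology of the complex $\big((\Lambda^p(\mathfrak g/\mathfrak l)^*)^{\mathfrak l}\big)_{p\ge 0}$ with the Chevalley–Eilenberg differential, and let $$i: H^p(\mathfrak g,\mathfrak h;\mathbb R)\to H^p(\mathfrak g,\mathfrak k_H;\mathbb R)$$ be the homomorphism induced by the inclusion $\mathfrak k_H\subset\mathfrak h$. If $i$ is injective for $p=N$, then it is injective for all $0\le p\le N-1$. -/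

import Mathlib

open scoped Manifold ContDiff

namespace RelLie

section Subquotient

variable {V : Type*} [AddCommGroup V] [Module ℝ V]

/-- The quotient of `Z` by `B` (by `B ∩ Z`, should `B` not be contained in `Z`), for subspaces
`Z`, `B` of a real vector space. -/
abbrev Subquotient (Z B : Submodule ℝ V) : Type _ := Z ⧸ B.submoduleOf Z

/-- The map `Z ⧸ B → Z' ⧸ B'` induced by inclusions `Z ⊆ Z'` and `B ⊆ B'`. -/
def subquotientMap {Z B Z' B' : Submodule ℝ V} (hZ : Z ≤ Z') (hB : B ≤ B') :
    Subquotient Z B →ₗ[ℝ] Subquotient Z' B' :=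
  Submodule.mapQ _ _ (Submodule.inclusion hZ) (fun _ hα => hB hα)

end Subquotient

section Algebra

variable {𝔤 : Type*} [LieRing 𝔤] [LieAlgebra ℝ 𝔤]

/-- The action `ℒ x` of `x ∈ 𝔤` on alternating forms on `𝔤` (coadjoint action):
`(ℒ x α)(v₁, …, vₚ) = - ∑ⱼ α(v₁, …, [x, vⱼ], …, vₚ)`. -/
noncomputable def lieDer {p : ℕ} (x : 𝔤) (α : 𝔤 [⋀^Fin p]→ₗ[ℝ] ℝ) : 𝔤 [⋀^Fin p]→ₗ[ℝ] ℝ where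
  toFun v := -∑ j, α (Function.update v j ⁅x, v j⁆)
  map_update_add' := by
    intro inst v i a b
    obtain rfl : inst = instDecidableEqFin p := Subsingleton.elim _ _
    rw [← neg_add, ← Finset.sum_add_distrib]
    congr 1
    refine Finset.sum_congr rfl fun j _ => ?_
    by_cases h : j = i
    · subst h; simp
    · simp only [Function.update_of_ne h, Function.update_comm (Ne.symm h), AlternatingMap.map_update_add]
  map_update_smul' := by
    intro inst v i c a
    obtain rfl : inst = instDecidableEqFin p := Subsingleton.elim _ _
    rw [smul_neg, Finset.smul_sum]
    congr 1
    refine Finset.sum_congr rfl fun j _ => ?_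
    by_cases h : j = i
    · subst h; simp
    · simp only [Function.update_of_ne h, Function.update_comm (Ne.symm h), AlternatingMap.map_update_smul]
  map_eq_zero_of_eq' := by
    intro v i j hv hij
    rw [neg_eq_zero, Fintype.sum_eq_add i j hij]
    · have h : Function.update v j ⁅x, v j⁆ =
          Function.update v i ⁅x, v i⁆ ∘ Equiv.swap i j := by
        funext k
        by_cases hki : k = i
        · subst hki; simp [Function.update_of_ne hij, Function.update_of_ne hij.symm, hv]
        by_cases hkj : k = j
        · subst hkj; simp [hv]
        · simp [Equiv.swap_apply_of_ne_of_ne hki hkj, Function.update_of_ne hki,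
            Function.update_of_ne hkj]
      rw [h, AlternatingMap.map_swap _ _ hij, add_neg_cancel]
    · rintro k ⟨hki, hkj⟩
      refine α.map_eq_zero_of_eq _ ?_ hij
      rw [Function.update_of_ne hki.symm, Function.update_of_ne hkj.symm, hv]

@[simp]
theorem lieDer_apply {p : ℕ} (x : 𝔤) (α : 𝔤 [⋀^Fin p]→ₗ[ℝ] ℝ) (v : Fin p → 𝔤) :
    lieDer x α v = -∑ j, α (Function.update v j ⁅x, v j⁆) := rfl

/-- The action of `𝔤` on alternating `p`-forms, as a bilinear map. -/
noncomputable def lieDerLM (p : ℕ) :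
    𝔤 →ₗ[ℝ] (𝔤 [⋀^Fin p]→ₗ[ℝ] ℝ) →ₗ[ℝ] (𝔤 [⋀^Fin p]→ₗ[ℝ] ℝ) :=
  LinearMap.mk₂ ℝ lieDer
    (by intro x y α; ext v; simp [Finset.sum_add_distrib, add_comm])
    (by intro c x α; ext v; simp [Finset.mul_sum])
    (by intro x α β; ext v; simp [Finset.sum_add_distrib, add_comm])
    (by intro c x α; ext v; simp [Finset.mul_sum])

/-- The Chevalley–Eilenberg differential (trivial coefficients), through
`d = 1/2 ∑ₐ eᵃ ∧ ℒ eₐ`, i.e.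
`(dα)(x₀, …, xₚ) = 1/2 ∑ᵢ (-1)ⁱ (ℒ xᵢ α)(x₀, …, x̂ᵢ, …, xₚ)`.
Substituting the formula for `ℒ`, every pair `i < j` occurs twice, so this is
`(dα)(x₀, …, xₚ) = ∑_{i<j} (-1)^(i+j) α([xᵢ, xⱼ], x₀, …, x̂ᵢ, …, x̂ⱼ, …, xₚ)`. -/
noncomputable def ceDiff (p : ℕ) :
    (𝔤 [⋀^Fin p]→ₗ[ℝ] ℝ) →ₗ[ℝ] (𝔤 [⋀^Fin (p + 1)]→ₗ[ℝ] ℝ) :=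
  (1 / 2 : ℝ) • (AlternatingMap.alternatizeUncurryFinLM ∘ₗ (lieDerLM p).flip)

theorem ceDiff_apply {p : ℕ} (α : 𝔤 [⋀^Fin p]→ₗ[ℝ] ℝ) (v : Fin (p + 1) → 𝔤) :
    ceDiff p α v = 1 / 2 * ∑ i : Fin (p + 1), (-1) ^ (i : ℕ) * lieDer (v i) α (i.removeNth v) := by
  simp [ceDiff, lieDerLM, AlternatingMap.alternatizeUncurryFin_apply]

variable (𝔥 : LieSubalgebra ℝ 𝔤)

/-- The space `(Λᵖ (𝔤/𝔥)^*)^𝔥` of relative cochains: alternating `p`-forms on `𝔤` which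
vanish as soon as one argument lies in `𝔥` (so that they are forms on `𝔤/𝔥`), and are
invariant under `𝔥`. -/
noncomputable def relCochain (p : ℕ) : Submodule ℝ (𝔤 [⋀^Fin p]→ₗ[ℝ] ℝ) where
  carrier := {α | (∀ v : Fin p → 𝔤, (∃ i, v i ∈ 𝔥) → α v = 0) ∧ ∀ x ∈ 𝔥, lieDer x α = 0}
  zero_mem' := ⟨fun _ _ => rfl, fun x _ => ((lieDerLM p) x).map_zero⟩
  add_mem' := by
    rintro α β ⟨h1, h2⟩ ⟨h3, h4⟩
    refine ⟨fun v hv => by simp [h1 v hv, h3 v hv], fun x hx => ?_⟩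
    have := ((lieDerLM p) x).map_add α β
    exact this.trans (by rw [show (lieDerLM p) x α = 0 from h2 x hx,
      show (lieDerLM p) x β = 0 from h4 x hx, add_zero])
  smul_mem' := by
    rintro c α ⟨h1, h2⟩
    refine ⟨fun v hv => by simp [h1 v hv], fun x hx => ?_⟩
    have := ((lieDerLM p) x).map_smul c α
    exact this.trans (by rw [show (lieDerLM p) x α = 0 from h2 x hx, smul_zero])

/-- Relative cocycles. -/
noncomputable def relCocycle (p : ℕ) : Submodule ℝ (𝔤 [⋀^Fin p]→ₗ[ℝ] ℝ) :=
  relCochain 𝔥 p ⊓ LinearMap.ker (ceDiff p)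

/-- Relative coboundaries: differentials of relative cochains of one degree less. -/
noncomputable def relCoboundary : (p : ℕ) → Submodule ℝ (𝔤 [⋀^Fin p]→ₗ[ℝ] ℝ)
  | 0 => ⊥
  | p + 1 => (relCochain 𝔥 p).map (ceDiff p)

/-- Relative Lie algebra cohomology `Hᵖ(𝔤, 𝔥; ℝ)`: cocycles modulo coboundaries. -/
abbrev RelCohomology (p : ℕ) : Type _ :=
  Subquotient (relCocycle 𝔥 p) (relCoboundary 𝔥 p)

variable {𝔥} {𝔨 : LieSubalgebra ℝ 𝔤}

theorem relCochain_mono (h : 𝔨 ≤ 𝔥) (p : ℕ) : relCochain 𝔥 p ≤ relCochain 𝔨 p :=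
  fun _ hα => ⟨fun v ⟨i, hi⟩ => hα.1 v ⟨i, h hi⟩, fun x hx => hα.2 x (h hx)⟩

theorem relCocycle_mono (h : 𝔨 ≤ 𝔥) (p : ℕ) : relCocycle 𝔥 p ≤ relCocycle 𝔨 p :=
  inf_le_inf_right _ (relCochain_mono h p)

theorem relCoboundary_mono (h : 𝔨 ≤ 𝔥) : ∀ p, relCoboundary 𝔥 p ≤ relCoboundary 𝔨 p
  | 0 => le_rfl
  | p + 1 => Submodule.map_mono (relCochain_mono h p)

/-- The map `Hᵖ(𝔤, 𝔥; ℝ) → Hᵖ(𝔤, 𝔨; ℝ)` induced by an inclusion `𝔨 ⊆ 𝔥`; on cochains it is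
the inclusion `(Λᵖ (𝔤/𝔥)^*)^𝔥 ⊆ (Λᵖ (𝔤/𝔨)^*)^𝔨`. -/
noncomputable def relCohomologyMap (h : 𝔨 ≤ 𝔥) (p : ℕ) :
    RelCohomology 𝔥 p →ₗ[ℝ] RelCohomology 𝔨 p :=
  subquotientMap (relCocycle_mono h p) (relCoboundary_mono h p)

variable (𝔥) in
/-- `𝔥` is reductive in `𝔤`: the adjoint representation of `𝔥` on `𝔤` is semisimple, that is,
every `𝔥`-stable subspace of `𝔤` has an `𝔥`-stable complement. -/
def IsReductiveIn : Prop := ComplementedLattice (LieSubmodule ℝ 𝔥 𝔤)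

variable (𝔤) in
/-- The adjoint action of `𝔤` on itself is trace-free. -/
def AdTraceFree : Prop := ∀ x : 𝔤, LinearMap.trace ℝ 𝔤 (LieAlgebra.ad ℝ 𝔤 x : Module.End ℝ 𝔤) = 0

variable (𝔥) in
/-- The codimension of `𝔥` in `𝔤`. -/
noncomputable def codim : ℕ := Module.finrank ℝ (𝔤 ⧸ 𝔥.toSubmodule)

end Algebra

section Calc
open Set Filter Topology
variable {E : Type*} [NormedAddCommGroup E] [NormedSpace ℝ E]

theorem fderiv_inl_of_unit {f : E × E → E} {x₀ : E} (hf : ContDiffAt ℝ ∞ f (x₀, x₀))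
    (h : ∀ᶠ x in 𝓝 x₀, f (x, x₀) = x) (X : E) : fderiv ℝ f (x₀, x₀) (X, 0) = X := by
  have h1 : HasFDerivAt f (fderiv ℝ f (x₀, x₀)) (x₀, x₀) :=
    (hf.differentiableAt (by simp)).hasFDerivAt
  have h2 : HasFDerivAt (fun x : E => f (x, x₀)) _ x₀ :=
    HasFDerivAt.comp x₀ h1 (hasFDerivAt_prodMk_left x₀ x₀)
  have h3 : HasFDerivAt (fun x : E => f (x, x₀)) (ContinuousLinearMap.id ℝ E) x₀ :=
    (hasFDerivAt_id x₀).congr_of_eventuallyEq h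
  simpa using congrArg (fun L : E →L[ℝ] E => L X) (h2.unique h3)

theorem fderiv_inr_of_unit {f : E × E → E} {x₀ : E} (hf : ContDiffAt ℝ ∞ f (x₀, x₀))
    (h : ∀ᶠ x in 𝓝 x₀, f (x₀, x) = x) (X : E) : fderiv ℝ f (x₀, x₀) (0, X) = X := by
  have h1 : HasFDerivAt f (fderiv ℝ f (x₀, x₀)) (x₀, x₀) :=
    (hf.differentiableAt (by simp)).hasFDerivAt
  have h2 : HasFDerivAt (fun x : E => f (x₀, x)) _ x₀ :=
    HasFDerivAt.comp x₀ h1 (hasFDerivAt_prodMk_right x₀ x₀)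
  have h3 : HasFDerivAt (fun x : E => f (x₀, x)) (ContinuousLinearMap.id ℝ E) x₀ :=
    (hasFDerivAt_id x₀).congr_of_eventuallyEq h
  simpa using congrArg (fun L : E →L[ℝ] E => L X) (h2.unique h3)

theorem hasDerivAt_conj {f : E × E → E} {x₀ X Y : E} {c d : ℝ → E} {F : ℝ × ℝ → E}
    (hf : ContDiffAt ℝ ∞ f (x₀, x₀))
    (hl : ∀ᶠ x in 𝓝 x₀, f (x, x₀) = x)
    (hc : HasDerivAt c X 0) (hd : HasDerivAt d Y 0) (hc0 : c 0 = x₀) (hd0 : d 0 = x₀)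
    (hF : ContDiffAt ℝ ∞ F (0, 0))
    (h0 : ∀ᶠ s in 𝓝 (0 : ℝ), F (0, s) = d s) (h1 : ∀ᶠ t in 𝓝 (0 : ℝ), F (t, 0) = x₀)
    (hFf : ∀ᶠ z in 𝓝 ((0 : ℝ), (0 : ℝ)), f (F z, c z.1) = f (c z.1, d z.2)) :
    HasDerivAt (fun t => fderiv ℝ F (t, 0) (0, 1))
      (fderiv ℝ (fun x => fderiv ℝ f (x, x₀) (0, Y)) x₀ X
        - fderiv ℝ (fun x => fderiv ℝ f (x, x₀) (0, X)) x₀ Y) 0 := by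
  have hf' : HasFDerivAt (fderiv ℝ f) (fderiv ℝ (fderiv ℝ f) (x₀, x₀)) (x₀, x₀) :=
    ((hf.fderiv_right (m := 1) (by norm_cast)).differentiableAt one_ne_zero).hasFDerivAt
  have hF' : HasFDerivAt (fderiv ℝ F) (fderiv ℝ (fderiv ℝ F) (0, 0)) (0, 0) :=
    ((hF.fderiv_right (m := 1) (by norm_cast)).differentiableAt one_ne_zero).hasFDerivAt
  have hev {P : ℝ × ℝ → Prop} (h : ∀ᶠ z in 𝓝 ((0 : ℝ), (0 : ℝ)), P z) :
      ∀ᶠ t in 𝓝 (0 : ℝ), ∀ᶠ s in 𝓝 (0 : ℝ), P (t, s) := by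
    rw [nhds_prod_eq] at h
    exact h.curry
  -- derivatives of the translated fields
  have hV (Z W : E) : fderiv ℝ (fun x => fderiv ℝ f (x, x₀) (0, Z)) x₀ W
      = fderiv ℝ (fderiv ℝ f) (x₀, x₀) (W, 0) (0, Z) := by
    have h2 : HasFDerivAt (fun x : E => fderiv ℝ f (x, x₀)) _ x₀ :=
      HasFDerivAt.comp x₀ hf' (hasFDerivAt_prodMk_left x₀ x₀)
    have h3 := h2.clm_apply (hasFDerivAt_const ((0 : E), Z) x₀)
    rw [h3.fderiv]
    simp
  have hsymm := hf.isSymmSndFDerivAt (by simpa using ENat.LEInfty.out)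
  rw [hV, hV, hsymm (Y, 0) (0, X)]
  set A : ℝ → E := fun t => fderiv ℝ F (t, 0) (0, 1) with hA
  have hAd : HasDerivAt A (fderiv ℝ (fderiv ℝ F) (0, 0) (1, 0) (0, 1)) 0 := by
    have h2 : HasFDerivAt (fun t : ℝ => fderiv ℝ F (t, 0)) _ 0 :=
      HasFDerivAt.comp (0 : ℝ) hF' (hasFDerivAt_prodMk_left (0 : ℝ) (0 : ℝ))
    have h3 := (h2.clm_apply (hasFDerivAt_const ((0 : ℝ), (1 : ℝ)) (0 : ℝ))).hasDerivAt
    simpa using h3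
  have hA0 : A 0 = Y := by
    have h2 : HasFDerivAt (fun s : ℝ => F (0, s)) _ 0 :=
      HasFDerivAt.comp (0 : ℝ) (hF.differentiableAt (by simp)).hasFDerivAt
        (hasFDerivAt_prodMk_right (0 : ℝ) (0 : ℝ))
    have h3 := (hd.congr_of_eventuallyEq h0).unique h2.hasDerivAt
    simpa [hA] using h3.symm
  have hcc : HasDerivAt (fun t => (x₀, c t)) (0, X) 0 := (hasDerivAt_const _ _).prodMk hc
  have hcc' : HasDerivAt (fun t => (c t, x₀)) (X, 0) 0 := hc.prodMk (hasDerivAt_const _ _)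
  have hdf : ∀ᶠ z in 𝓝 (x₀, x₀), DifferentiableAt ℝ f z := by
    filter_upwards [(hf.of_le (m := 1) (by norm_cast)).eventually (by simp)] with z hz
    exact hz.differentiableAt one_ne_zero
  have hdF : ∀ᶠ z in 𝓝 ((0 : ℝ), (0 : ℝ)), DifferentiableAt ℝ F z := by
    filter_upwards [(hF.of_le (m := 1) (by norm_cast)).eventually (by simp)] with z hz
    exact hz.differentiableAt one_ne_zero
  have key : (fun t => fderiv ℝ f (x₀, c t) (A t, 0)) =ᶠ[𝓝 0]
      fun t => fderiv ℝ f (c t, x₀) (0, Y) := by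
    have e1 : ∀ᶠ t in 𝓝 (0 : ℝ), DifferentiableAt ℝ f (x₀, c t) := by
      have := hcc.continuousAt; rw [ContinuousAt, hc0] at this; exact this.eventually hdf
    have e2 : ∀ᶠ t in 𝓝 (0 : ℝ), DifferentiableAt ℝ f (c t, x₀) := by
      have := hcc'.continuousAt; rw [ContinuousAt, hc0] at this; exact this.eventually hdf
    have e3 : ∀ᶠ t in 𝓝 (0 : ℝ), DifferentiableAt ℝ F (t, 0) :=
      (hev hdF).mono fun t ht => ht.self_of_nhds
    filter_upwards [e1, e2, e3, hev hFf, h1] with t g1 g2 g3 g4 g5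
    have i1 : HasDerivAt (fun s : ℝ => F (t, s)) (A t) 0 := by
      have h2 : HasFDerivAt (fun s : ℝ => F (t, s)) _ 0 :=
        HasFDerivAt.comp (0 : ℝ) g3.hasFDerivAt (hasFDerivAt_prodMk_right t (0 : ℝ))
      simpa [hA] using h2.hasDerivAt
    have i2 : HasDerivAt (fun s : ℝ => f (F (t, s), c t)) (fderiv ℝ f (x₀, c t) (A t, 0)) 0 := by
      refine HasFDerivAt.comp_hasDerivAt (0 : ℝ) ?_ (i1.prodMk (hasDerivAt_const (0 : ℝ) (c t)))
      rw [g5]; exact g1.hasFDerivAt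
    have i3 : HasDerivAt (fun s : ℝ => f (c t, d s)) (fderiv ℝ f (c t, x₀) (0, Y)) 0 := by
      refine HasFDerivAt.comp_hasDerivAt (0 : ℝ) ?_ ((hasDerivAt_const (0 : ℝ) (c t)).prodMk hd)
      rw [hd0]; exact g2.hasFDerivAt
    exact (i2.unique (i3.congr_of_eventuallyEq g4))
  have k1 : HasDerivAt (fun t => fderiv ℝ f (x₀, c t) (A t, 0))
      (fderiv ℝ (fderiv ℝ f) (x₀, x₀) (0, X) (Y, 0)
        + fderiv ℝ (fderiv ℝ F) (0, 0) (1, 0) (0, 1)) 0 := by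
    have h2 : HasDerivAt (fun t => fderiv ℝ f (x₀, c t)) _ 0 :=
      HasFDerivAt.comp_hasDerivAt (0 : ℝ) (by rw [hc0]; exact hf') hcc
    have h3 := h2.clm_apply (hAd.prodMk (hasDerivAt_const (0 : ℝ) (0 : E)))
    rw [hc0, hA0, fderiv_inl_of_unit hf hl] at h3
    exact h3
  have k2 : HasDerivAt (fun t => fderiv ℝ f (c t, x₀) (0, Y))
      (fderiv ℝ (fderiv ℝ f) (x₀, x₀) (X, 0) (0, Y)) 0 := by
    have h2 : HasDerivAt (fun t => fderiv ℝ f (c t, x₀)) _ 0 :=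
      HasFDerivAt.comp_hasDerivAt (0 : ℝ) (by rw [hc0]; exact hf') hcc'
    have h3 := h2.clm_apply (hasDerivAt_const (0 : ℝ) ((0 : E), Y))
    simpa using h3
  have := k1.unique (k2.congr_of_eventuallyEq key)
  rw [← this, add_sub_cancel_left]
  exact hAd
end Calc

section LieGroups
open Set Filter Topology

variable {E : Type*} [NormedAddCommGroup E] [NormedSpace ℝ E]
  {G : Type*} [TopologicalSpace G] [ChartedSpace E G] [Group G]

instance lieGroupMinSmoothness [LieGroup 𝓘(ℝ, E) ∞ G] :
    LieGroup 𝓘(ℝ, E) (minSmoothness ℝ 3) G := by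
  rw [minSmoothness_of_isRCLikeNormedField]; infer_instance

variable (E) in
/-- Smooth curves `γ : ℝ → G` with values in the subgroup `H` and `γ 0 = 1`. -/
structure IsCurveIn (H : Subgroup G) (γ : ℝ → G) : Prop where
  smooth : ContMDiff 𝓘(ℝ, ℝ) 𝓘(ℝ, E) ∞ γ
  mem : ∀ t, γ t ∈ H
  map_zero : γ 0 = 1

variable (E) in
/-- The velocity `γ'(0)` of a curve with `γ 0 = 1`, an element of the tangent space at `1`
(a copy of the model space `E`). -/
noncomputable def velocity (γ : ℝ → G) : GroupLieAlgebra 𝓘(ℝ, E) G :=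
  (mfderiv 𝓘(ℝ, ℝ) 𝓘(ℝ, E) γ 0 (1 : ℝ) : E)

variable (E G) in
/-- The chart of `G` around `1`. -/
noncomputable abbrev chartOne : PartialEquiv G E := extChartAt 𝓘(ℝ, E) (1 : G)

variable (E G) in
/-- The multiplication of `G` read in the chart around `1`. -/
noncomputable def chartMul (z : E × E) : E :=
  chartOne E G ((chartOne E G).symm z.1 * (chartOne E G).symm z.2)

theorem contDiffAt_chart [LieGroup 𝓘(ℝ, E) ∞ G] {F : Type*} [NormedAddCommGroup F]
    [NormedSpace ℝ F] {φ : F → G} {z : F}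
    (hφ : ContMDiffAt 𝓘(ℝ, F) 𝓘(ℝ, E) ∞ φ z) (h0 : φ z = 1) :
    ContDiffAt ℝ ∞ (fun t => chartOne E G (φ t)) z := by
  rw [← contMDiffAt_iff_contDiffAt]
  have : ContMDiffAt 𝓘(ℝ, E) 𝓘(ℝ, E) ∞ (chartOne E G) (φ z) := by
    rw [h0]; exact contMDiffAt_extChartAt
  exact this.comp z hφ

theorem hasDerivAt_chart [LieGroup 𝓘(ℝ, E) ∞ G] {γ : ℝ → G} (h0 : γ 0 = 1)
    (hγ : ContMDiffAt 𝓘(ℝ, ℝ) 𝓘(ℝ, E) ∞ γ 0) :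
    HasDerivAt (fun t => chartOne E G (γ t)) (velocity E γ) 0 := by
  have h1 := ((contDiffAt_chart hγ h0).differentiableAt (by simp)).hasDerivAt
  convert h1 using 1
  unfold velocity
  rw [(hγ.mdifferentiableAt (by simp)).mfderiv]
  simp only [writtenInExtChartAt, h0, Function.comp_def, extChartAt_model_space_eq_id,
    PartialEquiv.refl_symm, PartialEquiv.refl_coe, id, modelWithCornersSelf_coe, range_id,
    fderivWithin_univ]
  rfl

theorem chartMul_left : ∀ᶠ x in 𝓝 (chartOne E G 1), chartMul E G (x, chartOne E G 1) = x := by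
  filter_upwards [extChartAt_target_mem_nhds (I := 𝓘(ℝ, E)) (1 : G)] with x hx
  simp only [chartMul, extChartAt_to_inv, mul_one]
  exact (chartOne E G).right_inv hx

theorem chartMul_right : ∀ᶠ x in 𝓝 (chartOne E G 1), chartMul E G (chartOne E G 1, x) = x := by
  filter_upwards [extChartAt_target_mem_nhds (I := 𝓘(ℝ, E)) (1 : G)] with x hx
  simp only [chartMul, extChartAt_to_inv, one_mul]
  exact (chartOne E G).right_inv hx

theorem chartMul_chart {a b : G} (ha : a ∈ (chartOne E G).source)
    (hb : b ∈ (chartOne E G).source) :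
    chartMul E G (chartOne E G a, chartOne E G b) = chartOne E G (a * b) := by
  simp only [chartMul, (chartOne E G).left_inv ha, (chartOne E G).left_inv hb]

variable [LieGroup 𝓘(ℝ, E) ∞ G]

theorem contDiffAt_chartMul : ContDiffAt ℝ ∞ (chartMul E G) (chartOne E G 1, chartOne E G 1) := by
  have hs : ContMDiffAt 𝓘(ℝ, E) 𝓘(ℝ, E) ∞ (chartOne E G).symm (chartOne E G 1) :=
    (contMDiffOn_extChartAt_symm (1 : G)).contMDiffAt (extChartAt_target_mem_nhds _)
  refine contDiffAt_chart
    (φ := fun z : E × E => (chartOne E G).symm z.1 * (chartOne E G).symm z.2) ?_ (by simp)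
  have h1 : ContMDiffAt 𝓘(ℝ, E × E) 𝓘(ℝ, E) ∞ (fun z : E × E => (chartOne E G).symm z.1)
      (chartOne E G 1, chartOne E G 1) :=
    ContMDiffAt.comp (g := (chartOne E G).symm) (f := Prod.fst) _ hs
      contDiff_fst.contMDiff.contMDiffAt
  have h2 : ContMDiffAt 𝓘(ℝ, E × E) 𝓘(ℝ, E) ∞ (fun z : E × E => (chartOne E G).symm z.2)
      (chartOne E G 1, chartOne E G 1) :=
    ContMDiffAt.comp (g := (chartOne E G).symm) (f := Prod.snd) _ hs
      contDiff_snd.contMDiff.contMDiffAt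
  exact h1.mul h2

theorem velocity_mul {γ δ : ℝ → G} (hγ : ContMDiff 𝓘(ℝ, ℝ) 𝓘(ℝ, E) ∞ γ)
    (hδ : ContMDiff 𝓘(ℝ, ℝ) 𝓘(ℝ, E) ∞ δ) (hγ0 : γ 0 = 1) (hδ0 : δ 0 = 1) :
    velocity E (fun t => γ t * δ t) = velocity E γ + velocity E δ := by
  have h1 := hasDerivAt_chart hγ0 hγ.contMDiffAt
  have h2 := hasDerivAt_chart hδ0 hδ.contMDiffAt
  have h3 := hasDerivAt_chart (γ := fun t => γ t * δ t) (by simp [hγ0, hδ0])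
    (hγ.mul hδ).contMDiffAt
  have hf : HasFDerivAt (chartMul E G) (fderiv ℝ (chartMul E G) (chartOne E G 1, chartOne E G 1))
      (chartOne E G (γ 0), chartOne E G (δ 0)) := by
    rw [hγ0, hδ0]; exact (contDiffAt_chartMul.differentiableAt (by simp)).hasFDerivAt
  have h4 := hf.comp_hasDerivAt (0 : ℝ) (h1.prodMk h2)
  have e : (fun t => chartOne E G (γ t * δ t)) =ᶠ[𝓝 0]
      (chartMul E G) ∘ fun t => (chartOne E G (γ t), chartOne E G (δ t)) := by
    have hs : (chartOne E G).source ∈ 𝓝 (1 : G) := extChartAt_source_mem_nhds _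
    have c1 := hγ.continuous.continuousAt (x := 0)
    have c2 := hδ.continuous.continuousAt (x := 0)
    rw [ContinuousAt, hγ0] at c1
    rw [ContinuousAt, hδ0] at c2
    filter_upwards [c1 hs, c2 hs] with t g1 g2
    exact (chartMul_chart g1 g2).symm
  have h5 := h3.unique (h4.congr_of_eventuallyEq e)
  have h6 (X Y : E) : fderiv ℝ (chartMul E G) (chartOne E G 1, chartOne E G 1) (X, Y) = X + Y := by
    rw [show (X, Y) = (X, 0) + (0, Y) by simp, map_add,
      fderiv_inl_of_unit contDiffAt_chartMul chartMul_left,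
      fderiv_inr_of_unit contDiffAt_chartMul chartMul_right]
  exact h5.trans (h6 _ _)

theorem velocity_smul {γ : ℝ → G} (hγ : ContMDiff 𝓘(ℝ, ℝ) 𝓘(ℝ, E) ∞ γ)
    (hγ0 : γ 0 = 1) (c : ℝ) : velocity E (fun t => γ (c * t)) = c • velocity E γ := by
  have hc : ContMDiff 𝓘(ℝ, ℝ) 𝓘(ℝ, ℝ) ∞ (fun t : ℝ => c * t) :=
    (contDiff_const.mul contDiff_id).contMDiff
  have h1 := hasDerivAt_chart hγ0 hγ.contMDiffAt
  have h2 := hasDerivAt_chart (γ := fun t => γ (c * t)) (by simp [hγ0])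
    (hγ.comp hc).contMDiffAt
  have h3 : HasDerivAt (fun t : ℝ => c * t) c 0 := by simpa using (hasDerivAt_id (0 : ℝ)).const_mul c
  have h4 : HasDerivAt (fun t => chartOne E G (γ t)) (velocity E γ) (c * 0) := by simpa using h1
  exact h2.unique (h4.scomp (0 : ℝ) h3)

theorem velocity_const : velocity E (fun _ => (1 : G)) = 0 := by
  have h2 := hasDerivAt_chart (E := E) (γ := fun _ => (1 : G)) rfl contMDiffAt_const
  exact h2.unique (hasDerivAt_const _ _)

theorem pullback_mulInvariantVectorField (Y : E) :
    ∀ᶠ x in 𝓝 (chartOne E G 1),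
      VectorField.mpullbackWithin 𝓘(ℝ, E) 𝓘(ℝ, E) (chartOne E G).symm
        (mulInvariantVectorField (Y : GroupLieAlgebra 𝓘(ℝ, E) G)) (range 𝓘(ℝ, E)) x
      = fderiv ℝ (chartMul E G) (x, chartOne E G 1) (0, Y) := by
  have hdf : ∀ᶠ z in 𝓝 (chartOne E G 1, chartOne E G 1), DifferentiableAt ℝ (chartMul E G) z := by
    filter_upwards [(contDiffAt_chartMul.of_le (m := 1) (by norm_cast)).eventually (by simp)]
      with z hz
    exact hz.differentiableAt one_ne_zero
  have hdf' : ∀ᶠ x in 𝓝 (chartOne E G 1),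
      DifferentiableAt ℝ (chartMul E G) (x, chartOne E G 1) :=
    (ContinuousAt.prodMk continuousAt_id continuousAt_const).eventually hdf
  filter_upwards [hdf', extChartAt_target_mem_nhds (I := 𝓘(ℝ, E)) (1 : G)] with x hx1 hx2
  set g := (chartOne E G).symm x with hg
  have hgs : g ∈ (chartOne E G).source := (chartOne E G).map_target hx2
  have i1 : (mfderivWithin 𝓘(ℝ, E) 𝓘(ℝ, E) (chartOne E G).symm (range 𝓘(ℝ, E)) x).inverse =
      mfderiv 𝓘(ℝ, E) 𝓘(ℝ, E) (chartOne E G) g :=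
    ContinuousLinearMap.inverse_eq
      (mfderivWithin_extChartAt_symm_comp_mfderiv_extChartAt hx2)
      (mfderiv_extChartAt_comp_mfderivWithin_extChartAt_symm hx2)
  rw [VectorField.mpullbackWithin_apply, i1]
  have d1 : MDifferentiableAt 𝓘(ℝ, E) 𝓘(ℝ, E) (g * ·) (1 : G) :=
    (contMDiff_mul_left (n := ∞)).mdifferentiableAt (by simp)
  have d2 : MDifferentiableAt 𝓘(ℝ, E) 𝓘(ℝ, E) (chartOne E G) (g * 1) := by
    rw [mul_one]
    exact mdifferentiableAt_extChartAt (by simpa using hgs)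
  have i2 : mfderiv 𝓘(ℝ, E) 𝓘(ℝ, E) (fun a => chartOne E G (g * a)) (1 : G) =
      (mfderiv 𝓘(ℝ, E) 𝓘(ℝ, E) (chartOne E G) (g * 1)).comp
        (mfderiv 𝓘(ℝ, E) 𝓘(ℝ, E) (g * ·) (1 : G)) := mfderiv_comp (1 : G) d2 d1
  have i0 : mfderiv 𝓘(ℝ, E) 𝓘(ℝ, E) (fun a => chartOne E G (g * a)) (1 : G) =
      fderivWithin ℝ (writtenInExtChartAt 𝓘(ℝ, E) 𝓘(ℝ, E) (1 : G)
        (fun a => chartOne E G (g * a))) (range 𝓘(ℝ, E)) (chartOne E G 1) :=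
    (MDifferentiableAt.comp (1 : G) d2 d1).mfderiv
  have h2 : HasFDerivAt (fun y : E => chartMul E G (x, y)) _ (chartOne E G 1) :=
    HasFDerivAt.comp (g := chartMul E G) (f := fun y : E => (x, y)) (chartOne E G 1) hx1.hasFDerivAt (hasFDerivAt_prodMk_right x _)
  have h3 : writtenInExtChartAt 𝓘(ℝ, E) 𝓘(ℝ, E) (1 : G) (fun a => chartOne E G (g * a)) =
      fun y : E => chartMul E G (x, y) := by
    funext y; simp only [writtenInExtChartAt, extChartAt_model_space_eq_id]; rfl
  rw [h3, modelWithCornersSelf_coe, range_id, fderivWithin_univ, h2.fderiv] at i0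
  have i4 := congrArg (fun L : E →L[ℝ] E => L Y) (i2.symm.trans i0)
  have i5 : ∀ k : G, k = g → (mfderiv 𝓘(ℝ, E) 𝓘(ℝ, E) (chartOne E G) k : E →L[ℝ] E) =
      (mfderiv 𝓘(ℝ, E) 𝓘(ℝ, E) (chartOne E G) g : E →L[ℝ] E) := by rintro k rfl; rfl
  refine Eq.trans ?_ (i4.trans (by simp))
  exact (congrArg (fun L : E →L[ℝ] E => L (mfderiv 𝓘(ℝ, E) 𝓘(ℝ, E) (g * ·) (1 : G) Y))
    (i5 (g * 1) (mul_one g))).symm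

theorem bracket_eq (X Y : E) :
    @Bracket.bracket (GroupLieAlgebra 𝓘(ℝ, E) G) (GroupLieAlgebra 𝓘(ℝ, E) G) _ X Y =
      fderiv ℝ (fun x => fderiv ℝ (chartMul E G) (x, chartOne E G 1) (0, Y)) (chartOne E G 1) X
      - fderiv ℝ (fun x => fderiv ℝ (chartMul E G) (x, chartOne E G 1) (0, X))
          (chartOne E G 1) Y := by
  have hX := pullback_mulInvariantVectorField (E := E) (G := G) X
  have hY := pullback_mulInvariantVectorField (E := E) (G := G) Y
  have h1 := (Filter.EventuallyEq.lieBracket_vectorField (𝕜 := ℝ) hX hY).self_of_nhds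
  simp only [VectorField.lieBracket] at h1
  rw [fderiv_inr_of_unit contDiffAt_chartMul chartMul_right,
    fderiv_inr_of_unit contDiffAt_chartMul chartMul_right] at h1
  refine Eq.trans (GroupLieAlgebra.bracket_def (I := 𝓘(ℝ, E)) (G := G) X Y) (Eq.trans ?_ h1)
  rw [← VectorField.mlieBracketWithin_univ,
    VectorField.mlieBracketWithin_apply, mfderiv_extChartAt_self]
  have h2 : (ContinuousLinearMap.id ℝ E).inverse = ContinuousLinearMap.id ℝ E :=
    ContinuousLinearMap.inverse_id
  refine Eq.trans (congrArg (fun L : E →L[ℝ] E => L _) h2) ?_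
  rw [preimage_univ, univ_inter]
  simp only [modelWithCornersSelf_coe, range_id]
  exact congrFun (VectorField.lieBracketWithin_univ (𝕜 := ℝ) (E := E)) _

variable [FiniteDimensional ℝ E]

/-- The Lie algebra of a closed subgroup `H` of the Lie group `G`, as a Lie subalgebra of the Lie
algebra `T₁G` of `G`: the velocities at `1` of the smooth curves `γ : ℝ → G` in `H` with `γ 0 = 1`.
For closed `H` these are exactly the `X` with `exp (tX) ∈ H` for all real `t`: one-parameter
subgroups are smooth, and conversely `exp (tX) = lim (γ (t / n)) ^ n` for `X = γ'(0)`. -/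
noncomputable def lieAlgebraOf (H : Subgroup G) : LieSubalgebra ℝ (GroupLieAlgebra 𝓘(ℝ, E) G) :=
  let S : Submodule ℝ (GroupLieAlgebra 𝓘(ℝ, E) G) :=
  { carrier := {X | ∃ γ : ℝ → G, IsCurveIn E H γ ∧ velocity E γ = X}
    zero_mem' := ⟨fun _ => 1, ⟨contMDiff_const, fun _ => H.one_mem, rfl⟩, velocity_const⟩
    add_mem' := by
      rintro _ _ ⟨γ, hγ, rfl⟩ ⟨δ, hδ, rfl⟩
      exact ⟨fun t => γ t * δ t, ⟨hγ.smooth.mul hδ.smooth, fun t => H.mul_mem (hγ.mem t) (hδ.mem t),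
        by simp [hγ.map_zero, hδ.map_zero]⟩,
        velocity_mul hγ.smooth hδ.smooth hγ.map_zero hδ.map_zero⟩
    smul_mem' := by
      rintro c _ ⟨γ, hγ, rfl⟩
      exact ⟨fun t => γ (c * t), ⟨hγ.smooth.comp (contDiff_const.mul contDiff_id).contMDiff,
        fun t => hγ.mem _, by simp [hγ.map_zero]⟩, velocity_smul hγ.smooth hγ.map_zero c⟩ }
  { S with
    lie_mem' := by
      rintro _ _ ⟨γ, hγ, rfl⟩ ⟨δ, hδ, rfl⟩
      set X : E := velocity E γ
      set Y : E := velocity E δ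
      let S' : Submodule ℝ E := S
      let Φ : ℝ × ℝ → G := fun z => γ z.1 * δ z.2 * (γ z.1)⁻¹
      have hΦ : ContMDiff 𝓘(ℝ, ℝ × ℝ) 𝓘(ℝ, E) ∞ Φ := by
        have h1 : ContMDiff 𝓘(ℝ, ℝ × ℝ) 𝓘(ℝ, E) ∞ fun z : ℝ × ℝ => γ z.1 :=
          hγ.smooth.comp contDiff_fst.contMDiff
        have h2 : ContMDiff 𝓘(ℝ, ℝ × ℝ) 𝓘(ℝ, E) ∞ fun z : ℝ × ℝ => δ z.2 :=
          hδ.smooth.comp contDiff_snd.contMDiff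
        exact (h1.mul h2).mul h1.inv
      have hΦt (t : ℝ) : Φ (t, 0) = 1 := by simp [Φ, hδ.map_zero]
      have hF (t : ℝ) : ContDiffAt ℝ ∞ (fun z => chartOne E G (Φ z)) (t, 0) :=
        contDiffAt_chart hΦ.contMDiffAt (hΦt t)
      have hsrc : (chartOne E G).source ∈ 𝓝 (1 : G) := extChartAt_source_mem_nhds _
      have key := hasDerivAt_conj (contDiffAt_chartMul (E := E) (G := G)) chartMul_left
        (hasDerivAt_chart hγ.map_zero hγ.smooth.contMDiffAt)
        (hasDerivAt_chart hδ.map_zero hδ.smooth.contMDiffAt)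
        (by simp [hγ.map_zero]) (by simp [hδ.map_zero]) (hF 0)
        (by simp [Φ, hγ.map_zero]) (by simp [hΦt]) (by
          have c1 := (hΦ.continuous).continuousAt (x := (0, 0))
          have c2 := (hγ.smooth.continuous.comp continuous_fst).continuousAt (x := ((0 : ℝ), (0 : ℝ)))
          have c3 := (hδ.smooth.continuous.comp continuous_snd).continuousAt (x := ((0 : ℝ), (0 : ℝ)))
          rw [ContinuousAt, hΦt] at c1
          rw [ContinuousAt, Function.comp_apply, hγ.map_zero] at c2
          rw [ContinuousAt, Function.comp_apply, hδ.map_zero] at c3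
          filter_upwards [c1 hsrc, c2 hsrc, c3 hsrc] with z g1 g2 g3
          rw [chartMul_chart (a := Φ z) (b := γ z.1) g1 g2,
            chartMul_chart (a := γ z.1) (b := δ z.2) g2 g3]
          simp [Φ])
      have hmem (t : ℝ) :
          fderiv ℝ (fun z => chartOne E G (Φ z)) (t, 0) (0, 1) ∈ S' := by
        have hc : ContMDiff 𝓘(ℝ, ℝ) 𝓘(ℝ, E) ∞ (fun s => Φ (t, s)) :=
          hΦ.comp (contDiff_const.prodMk contDiff_id).contMDiff
        refine ⟨fun s => Φ (t, s), ⟨hc, fun s => ?_, hΦt t⟩, ?_⟩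
        · exact H.mul_mem (H.mul_mem (hγ.mem t) (hδ.mem s)) (H.inv_mem (hγ.mem t))
        · have h2 : HasFDerivAt (fun s : ℝ => chartOne E G (Φ (t, s))) _ 0 :=
            HasFDerivAt.comp (g := fun z => chartOne E G (Φ z)) (f := fun s : ℝ => (t, s)) (0 : ℝ)
              ((hF t).differentiableAt (by simp)).hasFDerivAt
              (hasFDerivAt_prodMk_right t (0 : ℝ))
          exact (hasDerivAt_chart (hΦt t) hc.contMDiffAt).unique (by simpa using h2.hasDerivAt)
      have hcl : IsClosed (S' : Set E) := S'.closed_of_finiteDimensional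
      have hlim : fderiv ℝ (fun x => fderiv ℝ (chartMul E G) (x, chartOne E G 1) (0, Y))
          (chartOne E G 1) X - fderiv ℝ (fun x => fderiv ℝ (chartMul E G) (x, chartOne E G 1)
          (0, X)) (chartOne E G 1) Y ∈ S' := by
        refine hcl.mem_of_tendsto key.tendsto_slope (Filter.Eventually.of_forall fun t => ?_)
        exact S'.smul_mem _ (S'.sub_mem (hmem _) (hmem _))
      rw [← bracket_eq] at hlim
      exact hlim }

theorem mem_lieAlgebraOf {H : Subgroup G} {X : GroupLieAlgebra 𝓘(ℝ, E) G} :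
    X ∈ lieAlgebraOf H ↔ ∃ γ : ℝ → G, IsCurveIn E H γ ∧ velocity E γ = X := Iff.rfl

theorem lieAlgebraOf_mono {H K : Subgroup G} (h : K ≤ H) :
    (lieAlgebraOf K : LieSubalgebra ℝ (GroupLieAlgebra 𝓘(ℝ, E) G)) ≤ lieAlgebraOf H := by
  rintro _ ⟨γ, hγ, rfl⟩
  exact ⟨γ, ⟨hγ.smooth, fun t => h (hγ.mem t), hγ.map_zero⟩, rfl⟩

/-- `K` is a maximal compact subgroup of `H`: maximal among the subgroups of `H` that are compact. -/
def IsMaximalCompactIn {G : Type*} [TopologicalSpace G] [Group G] (K H : Subgroup G) : Prop :=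
  Maximal (fun K' : Subgroup G => K' ≤ H ∧ IsCompact (K' : Set G)) K

theorem IsMaximalCompactIn.le {G : Type*} [TopologicalSpace G] [Group G] {K H : Subgroup G}
    (h : IsMaximalCompactIn K H) : K ≤ H := h.prop.1

end LieGroups
end RelLie

/-! The mechanism is Poincaré duality, carried out on relative cochains. Let `α` be an `𝔥`-relative
cocycle of positive degree `r < N` with `α = dη`, where `η` is only `𝔨`-relative. If `α` is not the
differential of an `𝔥`-relative cochain, some functional `φ` kills the `𝔥`-relative coboundaries but
not `α`. The wedge product into the line `Λᴺ(𝔤/𝔥)^*` is a perfect pairing of relative cochains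
(`DualFrame.exists_wedge_eq`), so `φ` is the pairing with some `β` of degree `N - r`. Relative
coboundaries of degree `N` vanish, so by the Leibniz rule and nondegeneracy `φ` killing coboundaries
means `dβ = 0`. Then `α ∧ β` is a nonzero multiple of `d(η ∧ β)`: an `𝔥`-relative cocycle of degree
`N` that is a `𝔨`-relative coboundary. Injectivity in degree `N` makes it an `𝔥`-relative
coboundary, hence zero, which contradicts `φ α ≠ 0`.

Two facts carry this.

Traces: both `𝔤` and `𝔥` are unimodular, so along an `𝔥`-stable complement `C` of `𝔥` the `C`-block
of `ad y` has trace zero for every `y ∈ 𝔤` (`IsReductiveIn.exists_dualFrame`). Hence `ℒ_y vol = 0`.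
As every horizontal `(N-1)`-form is some `ι_y vol`, Cartan's formula kills top coboundaries
(`DualFrame.ceDiff_eq_zero`).

Invariants: horizontal forms are sums of invariant ones and of Lie derivatives along `𝔥`
(`IsReductiveIn.horForm_decomposition`). For invariant `α`, `α ∧ ℒ_x δ = ℒ_x (α ∧ δ) = 0`, so
nondegeneracy on all horizontal forms descends to invariants. The decomposition comes from a Casimir
and Fitting induction, `maxTrivSubmodule_sup_lie_top_eq_top`. -/

namespace RelLie

/-! ### Invariants and coinvariants of representations of reductive Lie algebras -/

section InvariantDecomposition

variable {L : Type*} [LieRing L] [LieAlgebra ℝ L] [FiniteDimensional ℝ L]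

attribute [local instance 100] LieRing.ofAssociativeRing

/-- A faithful representation with vanishing trace form forces solvability. -/
theorem isSolvable_of_traceForm_eq_zero {V : Type*} [AddCommGroup V] [Module ℝ V]
    [FiniteDimensional ℝ V] [LieRingModule L V] [LieModule ℝ L V]
    (hf : ∀ x : L, (∀ v : V, ⁅x, v⁆ = 0) → x = 0)
    (h : LieModule.traceForm ℝ L V = 0) : LieAlgebra.IsSolvable L := by
  have hinj : Function.Injective (LieModule.toEnd ℝ L V) := by
    rw [injective_iff_map_eq_zero]
    exact fun x hx => hf x fun v => LinearMap.congr_fun hx v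
  have hnil := LieModule.isNilpotent_derivedSeries_of_traceForm_eq_zero h
  set D := LieAlgebra.derivedSeries ℝ L 1 with hD
  -- Engel: elements of `D` act nilpotently on `V`, so they are ad-nilpotent in `End V`, and
  -- faithfulness carries this back to `L`.
  have hD' : LieRing.IsNilpotent D := by
    rw [LieAlgebra.isNilpotent_iff_forall (R := ℝ)]
    rintro ⟨x, hx⟩
    apply LieSubalgebra.isNilpotent_ad_of_isNilpotent_ad (D : LieSubalgebra ℝ L) (x := ⟨x, hx⟩)
    have h1 : IsNilpotent (LieModule.toEnd ℝ L V x) :=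
      (LieModule.isNilpotent_iff_forall' (R := ℝ)).mp hnil ⟨x, hx⟩
    obtain ⟨k, hk⟩ := LieAlgebra.ad_nilpotent_of_nilpotent (R := ℝ) h1
    refine ⟨k, LinearMap.ext fun y => hinj ?_⟩
    have h2 : ∀ m, LieModule.toEnd ℝ L V ((LieAlgebra.ad ℝ L x ^ m) y) =
        (LieAlgebra.ad ℝ (Module.End ℝ V) (LieModule.toEnd ℝ L V x) ^ m)
          (LieModule.toEnd ℝ L V y) := by
      intro m
      induction m with
      | zero => simp
      | succ m ih =>
        rw [pow_succ', pow_succ', Module.End.mul_apply, Module.End.mul_apply, ← ih,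
          LieAlgebra.ad_apply, LieAlgebra.ad_apply, LieHom.map_lie]
    have h3 := h2 k
    rw [hk] at h3
    simpa using h3
  obtain ⟨k, hk⟩ := LieAlgebra.IsSolvable.solvable ℝ D
  rw [LieIdeal.derivedSeries_eq_bot_iff] at hk
  refine LieAlgebra.IsSolvable.mk (R := ℝ) (k := k + 1) ?_
  rwa [LieAlgebra.derivedSeries_def, LieAlgebra.derivedSeriesOfIdeal_add]

/-- If all ideals are complemented, abelian ideals are central. -/
theorem lie_eq_zero_of_abelian_ideal {L : Type*} [LieRing L] [LieAlgebra ℝ L]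
    [ComplementedLattice (LieIdeal ℝ L)] (A : LieIdeal ℝ L) (hA : IsLieAbelian A) {a : L} (ha : a ∈ A)
    (x : L) : ⁅x, a⁆ = 0 := by
  obtain ⟨B, hB⟩ := exists_isCompl A
  have hx : x ∈ A ⊔ B := by rw [hB.sup_eq_top]; trivial
  obtain ⟨y, hy, z, hz, rfl⟩ := (LieSubmodule.mem_sup _ _ _).mp hx
  have h1 : ⁅y, a⁆ = 0 := congrArg Subtype.val (hA.trivial ⟨y, hy⟩ ⟨a, ha⟩)
  have h2 : ⁅z, a⁆ ∈ A ⊓ B := ⟨lie_mem_right ℝ L A z a ha, lie_mem_left ℝ L B z a hz⟩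
  rw [hB.inf_eq_bot] at h2
  rw [add_lie, h1, zero_add]
  exact (LieSubmodule.mem_bot _).mp h2

variable [ComplementedLattice (LieIdeal ℝ L)]

variable {V : Type*} [AddCommGroup V] [Module ℝ V]
    [FiniteDimensional ℝ V] [LieRingModule L V] [LieModule ℝ L V]

/-- If the centre acts trivially, the trace form is nondegenerate on a complement of the kernel. -/
theorem eq_zero_of_traceForm_eq_zero
    (hc : ∀ z : L, (∀ x : L, ⁅x, z⁆ = 0) → ∀ v : V, ⁅z, v⁆ = 0)
    {J : LieIdeal ℝ L} (hJ : IsCompl (LieModule.ker ℝ L V) J) {x : L} (hx : x ∈ J)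
    (h : ∀ y ∈ J, LieModule.traceForm ℝ L V x y = 0) : x = 0 := by
  have hker : ∀ y : L, y ∈ LieModule.ker ℝ L V ↔ ∀ v : V, ⁅y, v⁆ = 0 := fun y => by
    simp [LieModule.mem_ker]
  have hdisj : ∀ y ∈ J, (∀ v : V, ⁅y, v⁆ = 0) → y = 0 := fun y hy hv => by
    have : y ∈ LieModule.ker ℝ L V ⊓ J := ⟨(hker y).2 hv, hy⟩
    rw [hJ.inf_eq_bot] at this
    exact (LieSubmodule.mem_bot _).mp this
  -- The radical of the trace form on `J`. It acts faithfully because `J` meets the kernel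
  -- trivially, so it is solvable.
  let I : LieIdeal ℝ L :=
    { carrier := {x | x ∈ J ∧ ∀ y ∈ J, LieModule.traceForm ℝ L V x y = 0}
      zero_mem' := ⟨J.zero_mem, fun y _ => by simp⟩
      add_mem' := fun {a b} ha hb => ⟨J.add_mem ha.1 hb.1, fun y hy => by
        rw [map_add, LinearMap.add_apply, ha.2 y hy, hb.2 y hy, add_zero]⟩
      smul_mem' := fun c a ha => ⟨J.smul_mem c ha.1, fun y hy => by
        rw [map_smul, LinearMap.smul_apply, ha.2 y hy, smul_zero]⟩
      lie_mem := fun {z a} ha => ⟨lie_mem_right ℝ L J z a ha.1, fun y hy => by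
        rw [← lie_skew, map_neg, LinearMap.neg_apply, LieModule.traceForm_apply_lie_apply,
          ha.2 _ (lie_mem_right ℝ L J z y hy), neg_zero]⟩ }
  have hIs : LieAlgebra.IsSolvable I := by
    refine isSolvable_of_traceForm_eq_zero (V := V) (fun y hy => ?_) ?_
    · exact Subtype.ext (hdisj y y.2.1 hy)
    · ext a b
      exact a.2.2 b b.2.1
  have hI : I = ⊥ := by
    rw [← LieAlgebra.abelian_of_solvable_ideal_eq_bot_iff, eq_bot_iff]
    intro a ha
    -- The last nonzero term of the derived series of `I` is an abelian ideal, hence central, hence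
    -- acts by zero; by faithfulness it is zero, and so is `I`.
    have hle : LieAlgebra.derivedAbelianOfIdeal I ≤ I := by
      unfold LieAlgebra.derivedAbelianOfIdeal
      split
      · exact bot_le
      · exact LieAlgebra.derivedSeriesOfIdeal_le_self I _
    have hz := lie_eq_zero_of_abelian_ideal _ (LieAlgebra.abelian_derivedAbelianOfIdeal I) ha
    exact (LieSubmodule.mem_bot _).mpr (hdisj a (hle ha).1 (hc a hz))
  have hxI : x ∈ I := ⟨hx, h⟩
  rw [hI] at hxI
  exact (LieSubmodule.mem_bot _).mp hxI

/-- The Casimir endomorphism of a representation on which the centre acts trivially. -/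
theorem exists_casimir
    (hc : ∀ z : L, (∀ x : L, ⁅x, z⁆ = 0) → ∀ v : V, ⁅z, v⁆ = 0)
    (hV : ∃ x : L, ∃ v : V, ⁅x, v⁆ ≠ 0) :
    ∃ T : Module.End ℝ V, (∀ (x : L) (v : V), T ⁅x, v⁆ = ⁅x, T v⁆) ∧
      (∀ v, T v ∈ ⁅(⊤ : LieIdeal ℝ L), (⊤ : LieSubmodule ℝ L V)⁆) ∧ ¬ IsNilpotent T := by
  obtain ⟨J, hJ⟩ := exists_isCompl (LieModule.ker ℝ L V)
  let B : LinearMap.BilinForm ℝ J := (LieModule.traceForm ℝ L V).restrict J.toSubmodule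
  have hBs : B.IsSymm := ⟨fun x y => LieModule.traceForm_comm ℝ L V _ _⟩
  have hB : B.Nondegenerate := by
    refine hBs.isRefl.nondegenerate_iff_separatingLeft.mpr fun x hx => ?_
    exact Subtype.ext (eq_zero_of_traceForm_eq_zero hc hJ x.2 fun y hy => hx ⟨y, hy⟩)
  let b := Module.finBasis ℝ J
  let b' := B.dualBasis hB b
  let ρ := LieModule.toEnd ℝ L V
  refine ⟨∑ i, ρ (b i) * ρ (b' i), ?_, ?_, ?_⟩
  · intro x v
    -- Invariance of `B` makes the matrices of `ad x` in `b` and in the dual basis `b'` negative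
    -- transposes of each other, so the two extra Leibniz sums cancel.
    let a : Fin (Module.finrank ℝ J) → Fin (Module.finrank ℝ J) → ℝ := fun i j => B ⁅x, b i⁆ (b' j)
    have hb : ∀ i, ⁅x, (b i : L)⁆ = ∑ j, a i j • (b j : L) := fun i => by
      have h1 := (B.dualBasis hB b').sum_repr ⁅x, b i⁆
      simp only [LinearMap.BilinForm.dualBasis_repr_apply] at h1
      rw [LinearMap.BilinForm.dualBasis_dualBasis hB hBs] at h1
      have h2 := congrArg (Subtype.val) h1
      simpa using h2.symm
    have hb' : ∀ j, ⁅x, (b' j : L)⁆ = -∑ i, a i j • (b' i : L) := fun j => by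
      have h1 := b'.sum_repr ⁅x, b' j⁆
      simp only [b', LinearMap.BilinForm.dualBasis_repr_apply] at h1
      have h2 := congrArg (Subtype.val) h1
      rw [← Finset.sum_neg_distrib]
      refine Eq.trans (by simpa using h2.symm) (Finset.sum_congr rfl fun i _ => ?_)
      rw [← neg_smul]
      congr 1
      change LieModule.traceForm ℝ L V ⁅x, (b' j : L)⁆ (b i : L) =
        -LieModule.traceForm ℝ L V ⁅x, (b i : L)⁆ (b' j : L)
      rw [← lie_skew, map_neg, LinearMap.neg_apply, LieModule.traceForm_apply_lie_apply,
        LieModule.traceForm_comm]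
    have e1 : ∀ w : V, (∑ i, ρ (b i) * ρ (b' i)) w = ∑ i, ⁅(b i : L), ⁅(b' i : L), w⁆⁆ := fun w => by
      simp [ρ, LinearMap.sum_apply]
    rw [e1, e1, lie_sum]
    have e2 : ∀ i, ⁅x, ⁅(b i : L), ⁅(b' i : L), v⁆⁆⁆ = ⁅(b i : L), ⁅(b' i : L), ⁅x, v⁆⁆⁆ +
        (⁅⁅x, (b i : L)⁆, ⁅(b' i : L), v⁆⁆ + ⁅(b i : L), ⁅⁅x, (b' i : L)⁆, v⁆⁆) := fun i => by
      rw [leibniz_lie x (b i : L), leibniz_lie x (b' i : L), lie_add]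
      abel
    simp_rw [e2]
    rw [Finset.sum_add_distrib, Finset.sum_add_distrib, left_eq_add]
    simp_rw [hb, hb', neg_lie, sum_lie, lie_neg, lie_sum, smul_lie, lie_smul]
    rw [Finset.sum_neg_distrib, Finset.sum_comm, add_neg_cancel]
  · intro v
    simp only [LinearMap.sum_apply, Module.End.mul_apply]
    refine Submodule.sum_mem _ fun i _ => ?_
    exact LieSubmodule.lie_mem_lie (LieSubmodule.mem_top _) (LieSubmodule.mem_top _)
  · intro hnil
    -- Each summand of the Casimir has trace `B (b i) (b' i) = 1`, so its trace is `dim J`.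
    -- Nilpotency would give `J = 0`, that is, a trivial action.
    have h1 := (LinearMap.isNilpotent_trace_of_isNilpotent hnil).eq_zero
    have h2 : ∀ i, LinearMap.trace ℝ V (ρ (b i) * ρ (b' i)) = 1 := fun i =>
      (LinearMap.BilinForm.apply_dualBasis_right hB hBs b i i).trans (if_pos rfl)
    rw [map_sum, Finset.sum_congr rfl fun i _ => h2 i] at h1
    have h3 : Module.finrank ℝ J = 0 := by simpa using h1
    obtain ⟨x, v, hxv⟩ := hV
    have hJ0 : J = ⊥ := by
      rw [← LieSubmodule.toSubmodule_eq_bot]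
      exact Submodule.finrank_eq_zero.mp h3
    have hk : LieModule.ker ℝ L V = ⊤ := by
      have := hJ.sup_eq_top
      rwa [hJ0, sup_bot_eq] at this
    have hx : x ∈ LieModule.ker ℝ L V := by rw [hk]; trivial
    rw [LieModule.mem_ker] at hx
    exact hxv (hx v)

/-- **Invariants and coinvariants.** A finite-dimensional representation of a reductive Lie algebra
whose centre acts semisimply is the sum of its invariants and of `⁅L, V⁆`. -/
theorem maxTrivSubmodule_sup_lie_top_eq_top
    (hs : ∀ z : L, (∀ x : L, ⁅x, z⁆ = 0) → (LieModule.toEnd ℝ L V z).IsSemisimple) :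
    LieModule.maxTrivSubmodule ℝ L V ⊔ ⁅(⊤ : LieIdeal ℝ L), (⊤ : LieSubmodule ℝ L V)⁆ = ⊤ := by
  induction hn : Module.finrank ℝ V using Nat.strong_induction_on generalizing V with
  | _ n ih =>
  by_cases hV : ∃ x : L, ∃ v : V, ⁅x, v⁆ ≠ 0
  swap
  · push Not at hV
    rw [eq_top_iff]
    intro v _
    exact (le_sup_left (a := LieModule.maxTrivSubmodule ℝ L V))
      ((LieModule.mem_maxTrivSubmodule ℝ L V v).mpr fun x => hV x v)
  -- `T` is the Casimir if the centre acts trivially; otherwise a central element acting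
  -- nontrivially, which is not nilpotent because it is semisimple and nonzero.
  obtain ⟨T, hT, hTr, hTn⟩ : ∃ T : Module.End ℝ V, (∀ (x : L) (v : V), T ⁅x, v⁆ = ⁅x, T v⁆) ∧
      (∀ v, T v ∈ ⁅(⊤ : LieIdeal ℝ L), (⊤ : LieSubmodule ℝ L V)⁆) ∧ ¬ IsNilpotent T := by
    by_cases hc : ∀ z : L, (∀ x : L, ⁅x, z⁆ = 0) → ∀ v : V, ⁅z, v⁆ = 0
    · exact exists_casimir hc hV
    · push Not at hc
      obtain ⟨z, hz, v, hv⟩ := hc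
      refine ⟨LieModule.toEnd ℝ L V z, fun x w => ?_, fun w => ?_, fun hnil => ?_⟩
      · rw [LieModule.toEnd_apply_apply, LieModule.toEnd_apply_apply, leibniz_lie x z w, hz,
          zero_lie, zero_add]
      · exact LieSubmodule.lie_mem_lie (LieSubmodule.mem_top _) (LieSubmodule.mem_top _)
      · have := Module.End.eq_zero_of_isNilpotent_isSemisimple hnil (hs z hz)
        exact hv (LinearMap.congr_fun this v)
  -- Fitting decomposition: the range of `T ^ k` lies in `⁅L, V⁆` (this needs `k > 0`), and the
  -- kernel is a proper submodule, to which induction applies.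
  obtain ⟨k, hk0, hk⟩ := ((Filter.eventually_gt_atTop 0).and
    T.eventually_isCompl_ker_pow_range_pow).exists
  have hTk : ∀ m, ∀ (x : L) (v : V), (T ^ m) ⁅x, v⁆ = ⁅x, (T ^ m) v⁆ := by
    intro m
    induction m with
    | zero => simp
    | succ m ihm => intro x v; rw [pow_succ', Module.End.mul_apply, ihm, hT, Module.End.mul_apply]
  let U : LieSubmodule ℝ L V :=
    { LinearMap.ker (T ^ k) with
      lie_mem := fun {x v} hv => by
        have hv' : (T ^ k) v = 0 := hv
        change (T ^ k) ⁅x, v⁆ = 0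
        rw [hTk, hv', lie_zero] }
  have hU : Module.finrank ℝ U < n := by
    rw [← hn]
    refine Submodule.finrank_lt (s := U.toSubmodule) fun h => hTn ⟨k, ?_⟩
    exact LinearMap.ker_eq_top.mp h
  have key := ih _ hU (V := U) (fun z hz => by
    have := (hs z hz).restrict (p := U.toSubmodule) (fun v hv => U.lie_mem hv)
    exact this) rfl
  rw [eq_top_iff]
  intro v _
  have hv : v ∈ LinearMap.ker (T ^ k) ⊔ LinearMap.range (T ^ k) := by rw [hk.sup_eq_top]; trivial
  obtain ⟨u, hu, _, ⟨w, rfl⟩, rfl⟩ := Submodule.mem_sup.mp hv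
  refine add_mem ?_ (le_sup_right (a := LieModule.maxTrivSubmodule ℝ L V) ?_)
  · have h1 : (⟨u, hu⟩ : U) ∈ LieModule.maxTrivSubmodule ℝ L U ⊔
        ⁅(⊤ : LieIdeal ℝ L), (⊤ : LieSubmodule ℝ L U)⁆ := by rw [key]; trivial
    have h2 : U.incl ⟨u, hu⟩ ∈ (LieModule.maxTrivSubmodule ℝ L U ⊔
        ⁅(⊤ : LieIdeal ℝ L), (⊤ : LieSubmodule ℝ L U)⁆).map U.incl :=
      LieSubmodule.mem_map_of_mem h1
    rw [LieSubmodule.map_sup, LieSubmodule.map_bracket_eq] at h2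
    refine sup_le_sup ?_ (LieSubmodule.mono_lie_right _ le_top) h2
    rintro _ ⟨y, hy, rfl⟩
    refine (LieModule.mem_maxTrivSubmodule ℝ L V _).mpr fun x => ?_
    exact congrArg Subtype.val ((LieModule.mem_maxTrivSubmodule ℝ L U _).mp hy x)
  · obtain ⟨k, rfl⟩ := Nat.exists_eq_succ_of_ne_zero hk0.ne'
    rw [Nat.succ_eq_add_one, pow_succ', Module.End.mul_apply]
    exact hTr _

end InvariantDecomposition

/-! ### Semisimplicity of operators acting slot by slot on multilinear forms -/

section SlotOperators

variable {W : Type*} [AddCommGroup W] [Module ℝ W] {q : ℕ}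

/-- The operator on multilinear forms applying `u` to the `j`-th argument. -/
noncomputable def slot (j : Fin q) :
    Module.End ℝ W →ₗ[ℝ] Module.End ℝ (MultilinearMap ℝ (fun _ : Fin q => W) ℝ) :=
  LinearMap.mk₂ ℝ (fun u f => f.compLinearMap (Function.update (fun _ => LinearMap.id) j u))
    (fun u u' f => by
      have h : ∀ (w : Module.End ℝ W) (v : Fin q → W),
          (fun i => (Function.update (fun _ => LinearMap.id) j w : Fin q → W →ₗ[ℝ] W) i (v i)) =
            Function.update v j (w (v j)) := fun w v => by
        funext i; by_cases hi : i = j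
        · subst hi; simp
        · simp [hi]
      ext v; simp [h])
    (fun c u f => by
      have h : ∀ (w : Module.End ℝ W) (v : Fin q → W),
          (fun i => (Function.update (fun _ => LinearMap.id) j w : Fin q → W →ₗ[ℝ] W) i (v i)) =
            Function.update v j (w (v j)) := fun w v => by
        funext i; by_cases hi : i = j
        · subst hi; simp
        · simp [hi]
      ext v; simp [h])
    (fun u f f' => by ext v; simp)
    (fun c u f => by ext v; simp)

theorem slot_apply (j : Fin q) (u : Module.End ℝ W) (f : MultilinearMap ℝ (fun _ : Fin q => W) ℝ)
    (v : Fin q → W) : slot j u f v = f (Function.update v j (u (v j))) := by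
  change f (fun i => (Function.update (fun _ => LinearMap.id) j u : Fin q → W →ₗ[ℝ] W) i (v i)) = _
  congr 1
  funext i; by_cases hi : i = j
  · subst hi; simp
  · simp [hi]

theorem slot_pow (j : Fin q) (u : Module.End ℝ W) (n : ℕ) : slot j (u ^ n) = slot j u ^ n := by
  induction n with
  | zero => ext f v; simp [slot_apply]
  | succ n ih =>
    rw [pow_succ' (slot j u), ← ih]
    ext f v
    simp [slot_apply, pow_succ]

theorem slot_aeval (j : Fin q) (u : Module.End ℝ W) (P : Polynomial ℝ) :
    slot j (Polynomial.aeval u P) = Polynomial.aeval (slot j u) P := by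
  induction P using Polynomial.induction_on' with
  | add P Q hP hQ => rw [map_add, map_add, map_add, hP, hQ]
  | monomial n a =>
    rw [Polynomial.aeval_monomial, Polynomial.aeval_monomial, ← Algebra.smul_def,
      ← Algebra.smul_def, map_smul, slot_pow]

theorem slot_commute (i j : Fin q) (u : Module.End ℝ W) : Commute (slot i u) (slot j u) := by
  by_cases h : i = j
  · subst h; exact Commute.refl _
  · refine LinearMap.ext fun f => MultilinearMap.ext fun v => ?_
    simp only [Module.End.mul_apply, slot_apply]
    rw [Function.update_of_ne (Ne.symm h), Function.update_of_ne h, Function.update_comm h]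

/-- The squarefree minimal polynomial of `u` annihilates each `slot j u`, and over `ℝ` a sum of
commuting semisimple operators is semisimple. -/
theorem isSemisimple_sum_slot [FiniteDimensional ℝ W] {u : Module.End ℝ W} (hu : u.IsSemisimple)
    (s : Finset (Fin q)) : (∑ j ∈ s, slot j u).IsSemisimple := by
  classical
  induction s using Finset.induction_on with
  | empty => simp
  | insert j s hj ih =>
    rw [Finset.sum_insert hj]
    refine Module.End.IsSemisimple.add_of_commute
      (Commute.sum_right _ _ _ fun i _ => slot_commute j i u) ?_ ih
    refine Module.End.isSemisimple_of_squarefree_aeval_eq_zero hu.minpoly_squarefree ?_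
    rw [← slot_aeval, minpoly.aeval, map_zero]

end SlotOperators

/-! ### Forms on `𝔤` and on `𝔤/𝔥` as Lie algebra representations -/

section Forms

variable {𝔤 : Type*} [LieRing 𝔤] [LieAlgebra ℝ 𝔤]

/-- In the commutator, terms acting on two different slots cancel by symmetry; those acting twice on
one slot combine by the Jacobi identity. -/
theorem lieDer_lie {q : ℕ} (x y : 𝔤) (α : 𝔤 [⋀^Fin q]→ₗ[ℝ] ℝ) :
    lieDer ⁅x, y⁆ α = lieDer x (lieDer y α) - lieDer y (lieDer x α) := by
  ext v
  have key : ∀ x y : 𝔤, lieDer x (lieDer y α) v =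
      ∑ j, α (Function.update v j ⁅y, ⁅x, v j⁆⁆) + ∑ j, ∑ k, if k = j then 0 else
        α (Function.update (Function.update v j ⁅x, v j⁆) k ⁅y, v k⁆) := fun x y => by
    simp only [lieDer_apply, Finset.sum_neg_distrib, neg_neg]
    rw [← Finset.sum_add_distrib]
    refine Finset.sum_congr rfl fun j _ => ?_
    rw [← Finset.add_sum_erase _ _ (Finset.mem_univ j),
      ← Finset.add_sum_erase (a := j) (f := fun k => if k = j then (0 : ℝ) else _) _
        (Finset.mem_univ j), if_pos rfl, zero_add]
    congr 1
    · simp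
    · refine Finset.sum_congr rfl fun k hk => ?_
      have hkj := Finset.ne_of_mem_erase hk
      rw [if_neg hkj, Function.update_of_ne hkj]
  rw [AlternatingMap.sub_apply, key x y, key y x, Finset.sum_comm (f := fun j k => if k = j then
    (0 : ℝ) else α (Function.update (Function.update v j ⁅y, v j⁆) k ⁅x, v k⁆))]
  have h2 : ∑ y_1, ∑ x_1, (if y_1 = x_1 then (0 : ℝ) else
      α (Function.update (Function.update v x_1 ⁅y, v x_1⁆) y_1 ⁅x, v y_1⁆)) =
      ∑ j, ∑ k, if k = j then 0 else
        α (Function.update (Function.update v j ⁅x, v j⁆) k ⁅y, v k⁆) := by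
    refine Finset.sum_congr rfl fun j _ => Finset.sum_congr rfl fun k _ => ?_
    by_cases h : j = k
    · rw [if_pos h, if_pos h.symm]
    · rw [if_neg h, if_neg (Ne.symm h), Function.update_comm h]
  rw [h2, add_sub_add_right_eq_sub, ← Finset.sum_sub_distrib, lieDer_apply,
    ← Finset.sum_neg_distrib]
  refine Finset.sum_congr rfl fun j _ => ?_
  rw [← AlternatingMap.map_update_sub, ← AlternatingMap.map_update_neg, lie_lie, neg_sub]

theorem finiteDimensional_alternatingMap [FiniteDimensional ℝ 𝔤] (q : ℕ) :
    FiniteDimensional ℝ (𝔤 [⋀^Fin q]→ₗ[ℝ] ℝ) :=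
  Module.Finite.of_injective (AlternatingMap.toMultilinearMapLM (R := ℝ) (S := ℝ))
    AlternatingMap.coe_multilinearMap_injective

/-- Alternating forms embed in multilinear forms, where `ℒ z` becomes minus the sum of the slot
operators of `ad z`; the squarefree minimal polynomial of that sum also annihilates `ℒ z`. -/
theorem isSemisimple_lieDerLM [FiniteDimensional ℝ 𝔤] {z : 𝔤}
    (hz : (LieAlgebra.ad ℝ 𝔤 z : Module.End ℝ 𝔤).IsSemisimple) (q : ℕ) :
    Module.End.IsSemisimple (lieDerLM q z) := by
  have hS := isSemisimple_sum_slot hz (Finset.univ : Finset (Fin q))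
  rw [← Module.End.isSemisimple_neg] at hS
  set S := -∑ j : Fin q, slot j (LieAlgebra.ad ℝ 𝔤 z : Module.End ℝ 𝔤)
  have h1 : ∀ α, (lieDerLM q z α).toMultilinearMap = S α.toMultilinearMap := fun α => by
    ext v
    simp [S, slot_apply, lieDerLM, LinearMap.sum_apply]
  have h2 : ∀ (P : Polynomial ℝ) α, (Polynomial.aeval (lieDerLM q z) P α).toMultilinearMap =
      Polynomial.aeval S P α.toMultilinearMap := fun P => by
    induction P using Polynomial.induction_on' with
    | add P Q hP hQ => intro α; rw [map_add, map_add, LinearMap.add_apply, LinearMap.add_apply,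
        AlternatingMap.coe_add, hP, hQ]
    | monomial n a =>
      have h3 : ∀ α, ((lieDerLM q z ^ n) α).toMultilinearMap = (S ^ n) α.toMultilinearMap := by
        induction n with
        | zero => simp
        | succ n ih => intro α; rw [pow_succ, pow_succ, Module.End.mul_apply,
            Module.End.mul_apply, ih, h1]
      intro α
      rw [Polynomial.aeval_monomial, Polynomial.aeval_monomial, ← Algebra.smul_def,
        ← Algebra.smul_def, LinearMap.smul_apply, LinearMap.smul_apply, ← h3]
      rfl
  refine Module.End.isSemisimple_of_squarefree_aeval_eq_zero hS.minpoly_squarefree ?_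
  ext α : 1
  apply AlternatingMap.coe_multilinearMap_injective
  have h3 : Polynomial.aeval S (minpoly ℝ S) = 0 := minpoly.aeval ℝ S
  exact (h2 _ α).trans (LinearMap.congr_fun h3 _)

/-- Alternating forms on `𝔤` vanishing when an argument is in `𝔥`, i.e. forms on `𝔤 ⧸ 𝔥`. -/
def horForm (𝔥 : LieSubalgebra ℝ 𝔤) (q : ℕ) : Submodule ℝ (𝔤 [⋀^Fin q]→ₗ[ℝ] ℝ) where
  carrier := {α | ∀ v : Fin q → 𝔤, (∃ i, v i ∈ 𝔥) → α v = 0}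
  zero_mem' := fun _ _ => rfl
  add_mem' := fun {α β} h1 h2 v hv => by simp [h1 v hv, h2 v hv]
  smul_mem' := fun c α h1 v hv => by simp [h1 v hv]

variable {𝔥 : LieSubalgebra ℝ 𝔤}

theorem mem_relCochain {q : ℕ} {α : 𝔤 [⋀^Fin q]→ₗ[ℝ] ℝ} :
    α ∈ relCochain 𝔥 q ↔ α ∈ horForm 𝔥 q ∧ ∀ x ∈ 𝔥, lieDer x α = 0 := Iff.rfl

theorem lieDer_mem_horForm {q : ℕ} {α : 𝔤 [⋀^Fin q]→ₗ[ℝ] ℝ} (hα : α ∈ horForm 𝔥 q) {x : 𝔤}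
    (hx : x ∈ 𝔥) : lieDer x α ∈ horForm 𝔥 q := by
  rintro v ⟨i, hi⟩
  rw [lieDer_apply, neg_eq_zero]
  refine Finset.sum_eq_zero fun j _ => hα _ ⟨i, ?_⟩
  by_cases h : i = j
  · subst h; rw [Function.update_self]; exact 𝔥.lie_mem hx hi
  · rwa [Function.update_of_ne h]

theorem lieDer_add_left {q : ℕ} (x y : 𝔤) (α : 𝔤 [⋀^Fin q]→ₗ[ℝ] ℝ) :
    lieDer (x + y) α = lieDer x α + lieDer y α :=
  LinearMap.congr_fun ((lieDerLM q).map_add x y) α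

theorem lieDer_smul_left {q : ℕ} (c : ℝ) (x : 𝔤) (α : 𝔤 [⋀^Fin q]→ₗ[ℝ] ℝ) :
    lieDer (c • x) α = c • lieDer x α :=
  LinearMap.congr_fun ((lieDerLM q).map_smul c x) α

theorem lieDer_add {q : ℕ} (x : 𝔤) (α β : 𝔤 [⋀^Fin q]→ₗ[ℝ] ℝ) :
    lieDer x (α + β) = lieDer x α + lieDer x β := (lieDerLM q x).map_add α β

theorem lieDer_smul {q : ℕ} (x : 𝔤) (c : ℝ) (α : 𝔤 [⋀^Fin q]→ₗ[ℝ] ℝ) :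
    lieDer x (c • α) = c • lieDer x α := (lieDerLM q x).map_smul c α

theorem lieDer_zero {q : ℕ} (x : 𝔤) : lieDer x (0 : 𝔤 [⋀^Fin q]→ₗ[ℝ] ℝ) = 0 :=
  (lieDerLM q x).map_zero

noncomputable instance horFormLieRingModule (q : ℕ) : LieRingModule 𝔥 (horForm 𝔥 q) where
  bracket x α := ⟨lieDer x.1 α.1, lieDer_mem_horForm α.2 x.2⟩
  add_lie x y α := Subtype.ext (lieDer_add_left _ _ _)
  lie_add x α β := Subtype.ext (lieDer_add _ _ _)
  leibniz_lie x y α := Subtype.ext (by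
    change lieDer x.1 (lieDer y.1 α.1) = lieDer ⁅x.1, y.1⁆ α.1 + lieDer y.1 (lieDer x.1 α.1)
    rw [lieDer_lie, sub_add_cancel])

instance horFormLieModule (q : ℕ) : LieModule ℝ 𝔥 (horForm 𝔥 q) where
  smul_lie _ _ _ := Subtype.ext (lieDer_smul_left _ _ _)
  lie_smul _ _ _ := Subtype.ext (lieDer_smul _ _ _)

end Forms

/-! ### Consequences of reductivity in `𝔤` -/

section Reductive

attribute [local instance 100] LieRing.ofAssociativeRing

variable {𝔤 : Type*} [LieRing 𝔤] [LieAlgebra ℝ 𝔤] {𝔥 : LieSubalgebra ℝ 𝔤}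

/-- An ideal of `𝔥` is an `𝔥`-submodule of `𝔤`; intersecting a stable complement in `𝔤` with `𝔥`
gives a complementary ideal. -/
theorem IsReductiveIn.complementedLattice (hred : IsReductiveIn 𝔥) :
    ComplementedLattice (LieIdeal ℝ 𝔥) where
  exists_isCompl I := by
    have : ComplementedLattice (LieSubmodule ℝ 𝔥 𝔤) := hred
    let I' : LieSubmodule ℝ 𝔥 𝔤 :=
      { I.toSubmodule.map 𝔥.toSubmodule.subtype with
        lie_mem := by
          rintro x _ ⟨y, hy, rfl⟩
          exact ⟨⁅x, y⁆, lie_mem_right ℝ 𝔥 I x y hy, rfl⟩ }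
    obtain ⟨C, hC⟩ := exists_isCompl I'
    let J : LieIdeal ℝ 𝔥 :=
      { C.toSubmodule.comap 𝔥.toSubmodule.subtype with
        lie_mem := fun {x y} hy => C.lie_mem (x := x) (m := (y : 𝔤)) hy }
    refine ⟨J, ?_, ?_⟩
    · rw [disjoint_iff, eq_bot_iff]
      rintro y ⟨hy1, hy2⟩
      have h : (y : 𝔤) ∈ I' ⊓ C := ⟨⟨y, hy1, rfl⟩, hy2⟩
      rw [hC.inf_eq_bot] at h
      exact (LieSubmodule.mem_bot _).mpr (Subtype.ext ((LieSubmodule.mem_bot _).mp h))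
    · rw [codisjoint_iff, eq_top_iff]
      rintro y -
      have h : (y : 𝔤) ∈ I' ⊔ C := by rw [hC.sup_eq_top]; trivial
      obtain ⟨_, ⟨a, ha, rfl⟩, c, hc, hac⟩ := (LieSubmodule.mem_sup _ _ _).mp h
      refine (LieSubmodule.mem_sup _ _ _).mpr ⟨a, ha, y - a, ?_, by abel⟩
      change ((y - a : 𝔥) : 𝔤) ∈ C
      have : ((y - a : 𝔥) : 𝔤) = c := by
        rw [AddSubgroupClass.coe_sub, ← hac]; exact add_sub_cancel_left _ _
      rwa [this]

/-- Central elements of a subalgebra reductive in `𝔤` act semisimply on `𝔤`. -/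
theorem IsReductiveIn.isSemisimple_ad [FiniteDimensional ℝ 𝔤] (hred : IsReductiveIn 𝔥) {z : 𝔥}
    (hz : ∀ x : 𝔥, ⁅x, z⁆ = 0) : (LieAlgebra.ad ℝ 𝔤 (z : 𝔤) : Module.End ℝ 𝔤).IsSemisimple := by
  have : ComplementedLattice (LieSubmodule ℝ 𝔥 𝔤) := hred
  obtain ⟨n, hn, s, -, hnil, hs, hzns⟩ :=
    (LieAlgebra.ad ℝ 𝔤 (z : 𝔤) : Module.End ℝ 𝔤).exists_isNilpotent_isSemisimple
  suffices n = 0 by rwa [hzns, this, zero_add]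
  -- The nilpotent Jordan part `n` is a polynomial in `ad z`, so it commutes with `𝔥` and preserves
  -- every `𝔥`-submodule.
  have hcomm : ∀ (x : 𝔥) (v : 𝔤), n ⁅(x : 𝔤), v⁆ = ⁅(x : 𝔤), n v⁆ := fun x v => by
    have h1 : Commute (LieAlgebra.ad ℝ 𝔤 (z : 𝔤) : Module.End ℝ 𝔤)
        (LieAlgebra.ad ℝ 𝔤 (x : 𝔤) : Module.End ℝ 𝔤) := by
      refine LinearMap.ext fun w => ?_
      change ⁅(z : 𝔤), ⁅(x : 𝔤), w⁆⁆ = ⁅(x : 𝔤), ⁅(z : 𝔤), w⁆⁆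
      have h2 : ⁅(x : 𝔤), (z : 𝔤)⁆ = 0 := congrArg Subtype.val (hz x)
      rw [leibniz_lie (x : 𝔤) (z : 𝔤) w, h2, zero_lie, zero_add]
    have h3 : Commute n (LieAlgebra.ad ℝ 𝔤 (x : 𝔤) : Module.End ℝ 𝔤) := by
      have := Algebra.commute_of_mem_adjoin_singleton_of_commute hn h1.symm
      exact this.symm
    exact LinearMap.congr_fun h3 v
  have hstab : ∀ (C : LieSubmodule ℝ 𝔥 𝔤) (v : 𝔤), v ∈ C → n v ∈ C := fun C v hv =>
    by
      obtain ⟨P, rfl⟩ := Algebra.adjoin_mem_exists_aeval ℝ _ hn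
      have h1 : ∀ k, ((LieAlgebra.ad ℝ 𝔤 (z : 𝔤) : Module.End ℝ 𝔤) ^ k) v ∈ C := fun k => by
        induction k with
        | zero => exact hv
        | succ k ih => rw [pow_succ']; exact C.lie_mem (x := z) ih
      rw [Polynomial.aeval_eq_sum_range, LinearMap.sum_apply]
      exact Submodule.sum_mem C.toSubmodule fun k _ => C.smul_mem _ (h1 k)
  let K : LieSubmodule ℝ 𝔥 𝔤 :=
    { LinearMap.ker n with
      lie_mem := fun {x v} hv => by
        have hv' : n v = 0 := hv
        change n ⁅(x : 𝔤), v⁆ = 0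
        rw [hcomm, hv', lie_zero] }
  obtain ⟨C, hC⟩ := exists_isCompl K
  -- On the stable complement `C` of `ker n`, `n` is injective as well as nilpotent, which forces `C
  -- = 0` and `n = 0`.
  have hCbot : ∀ k, ∀ v ∈ C, (n ^ k) v = 0 → v = 0 := by
    intro k
    induction k with
    | zero => intro v _ hv; simpa using hv
    | succ k ih =>
      intro v hv h
      rw [pow_succ, Module.End.mul_apply] at h
      have h2 : v ∈ K ⊓ C := ⟨ih _ (hstab C v hv) h, hv⟩
      rw [hC.inf_eq_bot] at h2
      exact (LieSubmodule.mem_bot _).mp h2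
  obtain ⟨k, hk⟩ := hnil
  refine LinearMap.ext fun v => ?_
  have hv : v ∈ K ⊔ C := by rw [hC.sup_eq_top]; trivial
  obtain ⟨a, ha, c, hc, rfl⟩ := (LieSubmodule.mem_sup _ _ _).mp hv
  rw [hCbot k c hc (by rw [hk]; rfl), add_zero]
  exact ha

/-- A subalgebra reductive in `𝔤` is unimodular. -/
theorem IsReductiveIn.adTraceFree (hred : IsReductiveIn 𝔥) : AdTraceFree 𝔥 := by
  have := hred.complementedLattice
  intro x
  -- The complementary ideal `Z` is central, since `[Z, 𝔥]` lies in `Z ∩ [𝔥, 𝔥] = 0`; on `[𝔥, 𝔥]`,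
  -- `ad` is a sum of commutators, so has trace zero.
  obtain ⟨Z, hZ⟩ := exists_isCompl (⁅(⊤ : LieIdeal ℝ 𝔥), (⊤ : LieIdeal ℝ 𝔥)⁆)
  have hx : x ∈ ⁅(⊤ : LieIdeal ℝ 𝔥), (⊤ : LieIdeal ℝ 𝔥)⁆ ⊔ Z := by rw [hZ.sup_eq_top]; trivial
  obtain ⟨y, hy, z, hz, rfl⟩ := (LieSubmodule.mem_sup _ _ _).mp hx
  have h1 : (LieAlgebra.ad ℝ 𝔥 z : Module.End ℝ 𝔥) = 0 := by
    refine LinearMap.ext fun w => ?_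
    have h2 : ⁅z, w⁆ ∈ ⁅(⊤ : LieIdeal ℝ 𝔥), (⊤ : LieIdeal ℝ 𝔥)⁆ ⊓ Z :=
      ⟨LieSubmodule.lie_mem_lie (LieSubmodule.mem_top _) (LieSubmodule.mem_top _),
        lie_mem_left ℝ 𝔥 Z z w hz⟩
    rw [hZ.inf_eq_bot] at h2
    exact (LieSubmodule.mem_bot _).mp h2
  have h3 : LinearMap.trace ℝ 𝔥 (LieAlgebra.ad ℝ 𝔥 y : Module.End ℝ 𝔥) = 0 := by
    rw [← LieSubmodule.mem_toSubmodule, LieSubmodule.lieIdeal_oper_eq_linear_span] at hy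
    clear hx
    induction hy using Submodule.span_induction with
    | mem w hw =>
      obtain ⟨a, b, rfl⟩ := hw
      rw [LieHom.map_lie, LieRing.of_associative_ring_bracket, map_sub, LinearMap.trace_mul_comm,
        sub_self]
    | zero => simp
    | add a b _ _ ha hb => rw [map_add, map_add, ha, hb, add_zero]
    | smul c a _ ha => rw [map_smul, map_smul, ha, smul_zero]
  rw [map_add, h1, add_zero, h3]

/-- Horizontal forms are sums of invariant ones and of Lie derivatives along `𝔥`. -/
theorem IsReductiveIn.horForm_decomposition [FiniteDimensional ℝ 𝔤] (hred : IsReductiveIn 𝔥)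
    {q : ℕ} {α : 𝔤 [⋀^Fin q]→ₗ[ℝ] ℝ} (hα : α ∈ horForm 𝔥 q) :
    ∃ β ∈ relCochain 𝔥 q, α - β ∈
      Submodule.span ℝ {γ | ∃ x ∈ 𝔥, ∃ δ ∈ horForm 𝔥 q, lieDer x δ = γ} := by
  have := hred.complementedLattice
  have := finiteDimensional_alternatingMap (𝔤 := 𝔤) q
  have htop := maxTrivSubmodule_sup_lie_top_eq_top (L := 𝔥) (V := horForm 𝔥 q) (fun z hz => by
    have h1 := isSemisimple_lieDerLM (hred.isSemisimple_ad hz) q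
    have h2 : horForm 𝔥 q ∈ Module.End.invtSubmodule (lieDerLM q (z : 𝔤)) :=
      fun δ hδ => lieDer_mem_horForm (x := z.1) hδ z.2
    exact h1.restrict h2)
  have h1 : (⟨α, hα⟩ : horForm 𝔥 q) ∈ LieModule.maxTrivSubmodule ℝ 𝔥 (horForm 𝔥 q) ⊔
      ⁅(⊤ : LieIdeal ℝ 𝔥), (⊤ : LieSubmodule ℝ 𝔥 (horForm 𝔥 q))⁆ := by rw [htop]; trivial
  obtain ⟨β, hβ, γ, hγ, hβγ⟩ := (LieSubmodule.mem_sup _ _ _).mp h1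
  refine ⟨β, ⟨β.2, fun x hx => ?_⟩, ?_⟩
  · exact congrArg Subtype.val ((LieModule.mem_maxTrivSubmodule ℝ 𝔥 _ _).mp hβ ⟨x, hx⟩)
  · have h2 : α - β = γ := by
      have := congrArg Subtype.val hβγ
      rw [← show (β : 𝔤 [⋀^Fin q]→ₗ[ℝ] ℝ) + γ = α from this, add_sub_cancel_left]
    rw [h2]
    rw [← LieSubmodule.mem_toSubmodule, LieSubmodule.lieIdeal_oper_eq_linear_span] at hγ
    have h3 := Submodule.mem_map_of_mem (f := (horForm 𝔥 q).subtype) hγ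
    rw [Submodule.map_span] at h3
    refine Submodule.span_mono ?_ h3
    rintro _ ⟨_, ⟨x, δ, rfl⟩, rfl⟩
    exact ⟨x.1.1, x.1.2, δ.1.1, δ.1.2, rfl⟩

end Reductive

/-! ### Cartan calculus: contraction, Lie derivative and differential -/

section CartanCalculus

variable {𝔤 : Type*} [LieRing 𝔤] [LieAlgebra ℝ 𝔤]

theorem ext_curryLeft {n : ℕ} {α β : 𝔤 [⋀^Fin (n + 1)]→ₗ[ℝ] ℝ}
    (h : ∀ x, α.curryLeft x = β.curryLeft x) : α = β := by
  ext v
  have := AlternatingMap.congr_fun (h (v 0)) (Matrix.vecTail v)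
  rw [AlternatingMap.curryLeft_apply_apply, AlternatingMap.curryLeft_apply_apply] at this
  rwa [show Matrix.vecCons (v 0) (Matrix.vecTail v) = v from Matrix.cons_head_tail v] at this

theorem curryLeft_lieDer {n : ℕ} (x y : 𝔤) (θ : 𝔤 [⋀^Fin (n + 1)]→ₗ[ℝ] ℝ) :
    (lieDer x θ).curryLeft y = lieDer x (θ.curryLeft y) - θ.curryLeft ⁅x, y⁆ := by
  ext u
  rw [AlternatingMap.sub_apply, AlternatingMap.curryLeft_apply_apply, lieDer_apply, lieDer_apply,
    Fin.sum_univ_succ, AlternatingMap.curryLeft_apply_apply, neg_add_rev, sub_eq_add_neg]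
  congr 2
  · refine Finset.sum_congr rfl fun j _ => ?_
    rw [AlternatingMap.curryLeft_apply_apply]
    exact congrArg θ (Fin.cons_update (α := fun _ => 𝔤) y u j _).symm
  · exact congrArg θ (Fin.update_cons_zero (α := fun _ => 𝔤) y u _)

/-- Cartan's formula `ι_x d + d ι_x = ℒ_x`. -/
theorem curryLeft_ceDiff {n : ℕ} (x : 𝔤) (θ : 𝔤 [⋀^Fin (n + 1)]→ₗ[ℝ] ℝ) :
    (ceDiff (n + 1) θ).curryLeft x = lieDer x θ - ceDiff n (θ.curryLeft x) := by
  ext w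
  rw [AlternatingMap.sub_apply, AlternatingMap.curryLeft_apply_apply, ceDiff_apply,
    Fin.sum_univ_succ, ceDiff_apply]
  have h0 : (Fin.removeNth 0 (Matrix.vecCons x w) : Fin (n + 1) → 𝔤) = w := by
    funext i; simp [Fin.removeNth]
  -- Commuting `ι_x` past `ℒ (w k)` leaves terms that sum to a second copy of `ℒ x θ`. With the copy
  -- from index `0`, this absorbs the factor `1/2` in the differential.
  have h1 : ∀ k : Fin (n + 1), (-1 : ℝ) ^ ((k.succ : Fin (n + 2)) : ℕ) *
      lieDer (Matrix.vecCons x w k.succ) θ (Fin.removeNth k.succ (Matrix.vecCons x w)) =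
      θ (Function.update w k ⁅w k, x⁆) -
        (-1) ^ (k : ℕ) * lieDer (w k) (θ.curryLeft x) (k.removeNth w) := fun k => by
    have h2 : (Fin.removeNth k.succ (Matrix.vecCons x w) : Fin (n + 1) → 𝔤) =
        Matrix.vecCons x (k.removeNth w) := by
      funext i
      refine Fin.cases ?_ (fun i => ?_) i <;> simp [Fin.removeNth]
    have h3 := AlternatingMap.congr_fun (curryLeft_lieDer (w k) x θ) (k.removeNth w)
    rw [AlternatingMap.sub_apply, AlternatingMap.curryLeft_apply_apply,
      AlternatingMap.curryLeft_apply_apply] at h3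
    have h4 : θ (Function.update w k ⁅w k, x⁆) =
        (-1) ^ (k : ℕ) * θ (Matrix.vecCons ⁅w k, x⁆ (k.removeNth w)) := by
      have := θ.map_insertNth k ⁅w k, x⁆ (k.removeNth w)
      rw [Fin.insertNth_removeNth] at this
      rw [this, zsmul_eq_mul]; simp
    rw [h2, Matrix.cons_val_succ, h3, h4, Fin.val_succ, pow_succ]
    ring
  simp_rw [h1]
  have h5 : ∑ k, θ (Function.update w k ⁅w k, x⁆) = lieDer x θ w := by
    rw [lieDer_apply, ← Finset.sum_neg_distrib]
    refine Finset.sum_congr rfl fun k _ => ?_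
    rw [← AlternatingMap.map_update_neg, lie_skew]
  rw [h0, Matrix.cons_val_zero, Finset.sum_sub_distrib, h5, Fin.val_zero]
  ring

theorem ceDiff_form_zero (α : 𝔤 [⋀^Fin 0]→ₗ[ℝ] ℝ) : ceDiff 0 α = 0 := by
  ext v
  rw [ceDiff_apply]
  simp

/-- By induction on the degree: contract both sides with an arbitrary `y` and apply Cartan's
formula. -/
theorem lieDer_ceDiff {n : ℕ} (x : 𝔤) (α : 𝔤 [⋀^Fin n]→ₗ[ℝ] ℝ) :
    lieDer x (ceDiff n α) = ceDiff n (lieDer x α) := by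
  induction n with
  | zero => rw [ceDiff_form_zero, ceDiff_form_zero, lieDer_zero]
  | succ n ih =>
    refine ext_curryLeft fun y => ?_
    have hsub : ∀ {m : ℕ} (β γ : 𝔤 [⋀^Fin m]→ₗ[ℝ] ℝ),
      lieDer x (β - γ) = lieDer x β - lieDer x γ := fun β γ => (lieDerLM _ x).map_sub β γ
    rw [curryLeft_lieDer, curryLeft_ceDiff, curryLeft_ceDiff, curryLeft_ceDiff, curryLeft_lieDer,
      hsub, ih, lieDer_lie, map_sub]
    abel

variable {𝔥 : LieSubalgebra ℝ 𝔤}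

theorem mem_horForm_succ {n : ℕ} {α : 𝔤 [⋀^Fin (n + 1)]→ₗ[ℝ] ℝ} :
    α ∈ horForm 𝔥 (n + 1) ↔ ∀ x ∈ 𝔥, α.curryLeft x = 0 := by
  refine ⟨fun h x hx => ?_, fun h v ⟨i, hi⟩ => ?_⟩
  · ext v
    exact h _ ⟨0, by simpa using hx⟩
  · have key : ∀ v : Fin (n + 1) → 𝔤, v 0 ∈ 𝔥 → α v = 0 := fun v hv => by
      have := AlternatingMap.congr_fun (h _ hv) (Matrix.vecTail v)
      rwa [AlternatingMap.curryLeft_apply_apply,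
        show Matrix.vecCons (v 0) (Matrix.vecTail v) = v from Matrix.cons_head_tail v] at this
    by_cases hi0 : i = 0
    · subst hi0; exact key v hi
    · have := α.map_swap v (Ne.symm hi0)
      rw [key (v ∘ Equiv.swap 0 i) (by simpa using hi), zero_eq_neg] at this
      exact this

/-- For `x ∈ 𝔥`, `ι_x dα = ℒ_x α - d ι_x α` has both terms zero, and `ℒ_x` commutes with `d`. -/
theorem ceDiff_mem_relCochain {n : ℕ} {α : 𝔤 [⋀^Fin n]→ₗ[ℝ] ℝ} (hα : α ∈ relCochain 𝔥 n) :
    ceDiff n α ∈ relCochain 𝔥 (n + 1) := by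
  rw [mem_relCochain] at hα ⊢
  refine ⟨?_, fun x hx => by rw [lieDer_ceDiff, hα.2 x hx, map_zero]⟩
  rw [mem_horForm_succ]
  intro x hx
  cases n with
  | zero => rw [ceDiff_form_zero]; rfl
  | succ n => rw [curryLeft_ceDiff, hα.2 x hx, mem_horForm_succ.mp hα.1 x hx, map_zero, sub_zero]

end CartanCalculus

/-! ### Wedge products and antisymmetrization -/

section Wedge

variable {W : Type*} [AddCommGroup W] [Module ℝ W] {p q n : ℕ}

/-- The wedge product of alternating forms, without normalizing factor; the bijection `e` places
the arguments. -/
noncomputable def wedge (e : Fin p ⊕ Fin q ≃ Fin n) (α : W [⋀^Fin p]→ₗ[ℝ] ℝ)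
    (β : W [⋀^Fin q]→ₗ[ℝ] ℝ) : W [⋀^Fin n]→ₗ[ℝ] ℝ :=
  MultilinearMap.alternatization (((LinearMap.mul' ℝ ℝ).compMultilinearMap
    (MultilinearMap.domCoprod α.toMultilinearMap β.toMultilinearMap)).domDomCongr e)

theorem wedge_apply (e : Fin p ⊕ Fin q ≃ Fin n) (α : W [⋀^Fin p]→ₗ[ℝ] ℝ)
    (β : W [⋀^Fin q]→ₗ[ℝ] ℝ) (v : Fin n → W) :
    wedge e α β v = ∑ σ : Equiv.Perm (Fin n), ((Equiv.Perm.sign σ : ℤ) : ℝ) *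
      (α (fun i => v (σ (e (Sum.inl i)))) * β (fun i => v (σ (e (Sum.inr i))))) := by
  rw [wedge, MultilinearMap.alternatization_apply]
  refine Finset.sum_congr rfl fun σ _ => ?_
  rw [← zsmul_eq_mul, Units.smul_def]
  rfl

/-- The usual sign `(-1)^(pq)` is absorbed in the placement of the arguments. -/
theorem wedge_comm (e : Fin p ⊕ Fin q ≃ Fin n) (α : W [⋀^Fin p]→ₗ[ℝ] ℝ)
    (β : W [⋀^Fin q]→ₗ[ℝ] ℝ) :
    wedge e α β = wedge ((Equiv.sumComm (Fin q) (Fin p)).trans e) β α := by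
  ext v
  rw [wedge_apply, wedge_apply]
  exact Finset.sum_congr rfl fun σ _ => congrArg _ (mul_comm _ _)

theorem wedge_add_left (e : Fin p ⊕ Fin q ≃ Fin n) (α α' : W [⋀^Fin p]→ₗ[ℝ] ℝ)
    (β : W [⋀^Fin q]→ₗ[ℝ] ℝ) : wedge e (α + α') β = wedge e α β + wedge e α' β := by
  ext v
  simp only [wedge_apply, AlternatingMap.add_apply, ← Finset.sum_add_distrib]
  exact Finset.sum_congr rfl fun σ _ => by ring

theorem wedge_smul_left (e : Fin p ⊕ Fin q ≃ Fin n) (c : ℝ) (α : W [⋀^Fin p]→ₗ[ℝ] ℝ)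
    (β : W [⋀^Fin q]→ₗ[ℝ] ℝ) : wedge e (c • α) β = c • wedge e α β := by
  ext v
  simp only [wedge_apply, AlternatingMap.smul_apply, smul_eq_mul, Finset.mul_sum]
  exact Finset.sum_congr rfl fun σ _ => by ring

theorem wedge_add_right (e : Fin p ⊕ Fin q ≃ Fin n) (α : W [⋀^Fin p]→ₗ[ℝ] ℝ)
    (β β' : W [⋀^Fin q]→ₗ[ℝ] ℝ) : wedge e α (β + β') = wedge e α β + wedge e α β' := by
  rw [wedge_comm, wedge_add_left, ← wedge_comm, ← wedge_comm]

theorem wedge_smul_right (e : Fin p ⊕ Fin q ≃ Fin n) (c : ℝ) (α : W [⋀^Fin p]→ₗ[ℝ] ℝ)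
    (β : W [⋀^Fin q]→ₗ[ℝ] ℝ) : wedge e α (c • β) = c • wedge e α β := by
  rw [wedge_comm, wedge_smul_left, ← wedge_comm]

/-- The wedge product as a bilinear map. -/
noncomputable def wedgeLM (e : Fin p ⊕ Fin q ≃ Fin n) :
    (W [⋀^Fin p]→ₗ[ℝ] ℝ) →ₗ[ℝ] (W [⋀^Fin q]→ₗ[ℝ] ℝ) →ₗ[ℝ] (W [⋀^Fin n]→ₗ[ℝ] ℝ) :=
  LinearMap.mk₂ ℝ (wedge e) (wedge_add_left e) (wedge_smul_left e) (wedge_add_right e)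
    (wedge_smul_right e)

@[simp]
theorem wedgeLM_apply (e : Fin p ⊕ Fin q ≃ Fin n) (α : W [⋀^Fin p]→ₗ[ℝ] ℝ)
    (β : W [⋀^Fin q]→ₗ[ℝ] ℝ) : wedgeLM e α β = wedge e α β := rfl

/-- Antisymmetrization over `Fin (n + 1)`, in two steps. -/
theorem sum_removeNth_sum_perm {W : Type*} (F : (Fin (n + 1) → W) → ℝ) (v : Fin (n + 1) → W) :
    ∑ i : Fin (n + 1), (-1 : ℝ) ^ (i : ℕ) * ∑ σ : Equiv.Perm (Fin n),
      ((Equiv.Perm.sign σ : ℤ) : ℝ) *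
        F (Fin.cons (v i) fun k => i.removeNth v (σ k)) =
    ∑ τ : Equiv.Perm (Fin (n + 1)), ((Equiv.Perm.sign τ : ℤ) : ℝ) * F (v ∘ τ) := by
  simp_rw [Finset.mul_sum]
  rw [← Fintype.sum_prod_type']
  -- A permutation of `Fin (n + 1)` amounts to the image `i` of `0` and a permutation of the rest;
  -- the cycle moving `0` to `i` contributes the sign `(-1)^i`.
  let Φ : Fin (n + 1) × Equiv.Perm (Fin n) → Equiv.Perm (Fin (n + 1)) := fun x =>
    x.1.cycleRange.symm * Equiv.Perm.decomposeFin.symm (0, x.2)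
  have h0 : ∀ x, Φ x 0 = x.1 := fun x => by simp [Φ]
  have hs : ∀ x k, Φ x (Fin.succ k) = x.1.succAbove (x.2 k) := fun x k => by simp [Φ]
  have hΦ : Function.Bijective Φ := by
    rw [Fintype.bijective_iff_injective_and_card]
    refine ⟨fun x y hxy => ?_, (Fintype.card_congr Equiv.Perm.decomposeFin).symm⟩
    have h1 : x.1 = y.1 := by rw [← h0 x, ← h0 y, hxy]
    refine Prod.ext h1 (Equiv.ext fun k => ?_)
    have h2 := hs x k
    rw [hxy, hs, ← h1] at h2
    exact (Fin.succAbove_right_injective h2).symm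
  refine Fintype.sum_bijective Φ hΦ _ _ fun x => ?_
  have hsign : ((Equiv.Perm.sign (Φ x) : ℤ) : ℝ) =
      (-1) ^ (x.1 : ℕ) * ((Equiv.Perm.sign x.2 : ℤ) : ℝ) := by
    simp [Φ, Equiv.Perm.sign_symm, Fin.sign_cycleRange]
  rw [hsign, mul_assoc]
  congr 3
  funext k
  refine Fin.cases ?_ (fun k => ?_) k
  · simp [h0]
  · simp [hs, Fin.removeNth]

theorem sum_sign_comp {W : Type*} (c : Equiv.Perm (Fin n)) (F : (Fin n → W) → ℝ) (v : Fin n → W) :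
    ∑ τ : Equiv.Perm (Fin n), ((Equiv.Perm.sign τ : ℤ) : ℝ) * F (v ∘ τ ∘ c) =
      ((Equiv.Perm.sign c : ℤ) : ℝ) *
        ∑ τ : Equiv.Perm (Fin n), ((Equiv.Perm.sign τ : ℤ) : ℝ) * F (v ∘ τ) := by
  rw [Finset.mul_sum]
  refine Fintype.sum_equiv (Equiv.mulRight c) _ _ fun τ => ?_
  have h : ((Equiv.Perm.sign c : ℤ) : ℝ) * ((Equiv.Perm.sign c : ℤ) : ℝ) = 1 := by
    rw [← Int.cast_mul, ← Units.val_mul, Int.units_mul_self]; simp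
  rw [Equiv.coe_mulRight, Equiv.Perm.sign_mul, Units.val_mul, Int.cast_mul, Equiv.Perm.coe_mul]
  linear_combination (-(((Equiv.Perm.sign τ : ℤ) : ℝ) * F (v ∘ τ ∘ c))) * h

/-- Both sides are multiples of the full antisymmetrization of `D(u₀)(…) β(…)`. On the right the `p
+ 1` summands of `alternatizeUncurryFin` contribute equally, so the constant is `±1/(p + 1)`,
whatever `D` and `β` are. -/
theorem exists_wedge_alternatizeUncurryFin (e : Fin p ⊕ Fin q ≃ Fin n)
    (e₁ : Fin (p + 1) ⊕ Fin q ≃ Fin (n + 1)) :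
    ∃ a : ℝ, a ≠ 0 ∧ ∀ (D : W →ₗ[ℝ] W [⋀^Fin p]→ₗ[ℝ] ℝ) (β : W [⋀^Fin q]→ₗ[ℝ] ℝ)
      (v : Fin (n + 1) → W), ∑ i : Fin (n + 1), (-1 : ℝ) ^ (i : ℕ) *
        wedge e (D (v i)) β (i.removeNth v) =
        a * wedge e₁ (AlternatingMap.alternatizeUncurryFin D) β v := by
  let f₀ : Fin (p + 1) ⊕ Fin q → Fin (n + 1) :=
    Sum.elim (Fin.cons 0 fun k => (e (Sum.inl k)).succ) fun k => (e (Sum.inr k)).succ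
  have hf₀ : Function.Bijective f₀ := by
    rw [Fintype.bijective_iff_injective_and_card]
    refine ⟨?_, Fintype.card_congr e₁⟩
    rintro (x | x) (y | y) h
    · revert h
      refine Fin.cases ?_ (fun x => ?_) x <;> refine Fin.cases ?_ (fun y => ?_) y <;>
        simp [f₀, Fin.succ_ne_zero, (Fin.succ_ne_zero _).symm]
    · revert h
      refine Fin.cases ?_ (fun x => ?_) x <;> simp [f₀, (Fin.succ_ne_zero _).symm]
    · revert h
      refine Fin.cases ?_ (fun x => ?_) y <;> simp [f₀, Fin.succ_ne_zero]
    · simpa [f₀] using h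
  let e₀ := Equiv.ofBijective f₀ hf₀
  let c₀ : Equiv.Perm (Fin (n + 1)) := e₀.symm.trans e₁
  let s : Fin (p + 1) → Equiv.Perm (Fin (p + 1) ⊕ Fin q) := fun i =>
    Equiv.Perm.sumCongr i.cycleRange.symm 1
  -- `c i` carries the reference placement `f₀` to the one that feeds slot `i` into `D`; its sign
  -- cancels the `(-1)^i` of the alternating sum.
  let c : Fin (p + 1) → Equiv.Perm (Fin (n + 1)) := fun i => (e₁.symm.trans ((s i).trans e₁)) * c₀
  have hc : ∀ i x, c i (f₀ x) = e₁ (s i x) := fun i x => by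
    have : e₀.symm (f₀ x) = x := e₀.symm_apply_apply x
    simp [c, c₀, this]
  have hsign : ∀ i : Fin (p + 1), (-1 : ℝ) ^ (i : ℕ) * ((Equiv.Perm.sign (c i) : ℤ) : ℝ) =
      ((Equiv.Perm.sign c₀ : ℤ) : ℝ) := fun i => by
    have h1 : Equiv.Perm.sign (c i) = (-1) ^ (i : ℕ) * Equiv.Perm.sign c₀ := by
      simp [c, s, Equiv.Perm.sign_symm, Fin.sign_cycleRange]
    rw [h1]
    push_cast
    rw [← mul_assoc, ← mul_pow]
    simp
  have hsq : ((Equiv.Perm.sign c₀ : ℤ) : ℝ) * ((Equiv.Perm.sign c₀ : ℤ) : ℝ) = 1 := by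
    rw [← Int.cast_mul, ← Units.val_mul, Int.units_mul_self]; simp
  have hp : ((p : ℝ) + 1) ≠ 0 := by positivity
  refine ⟨((Equiv.Perm.sign c₀ : ℤ) : ℝ) / (p + 1), ?_, fun D β v => ?_⟩
  · exact div_ne_zero (left_ne_zero_of_mul_eq_one hsq) hp
  let F : (Fin (n + 1) → W) → ℝ := fun u =>
    D (u 0) (fun k => u (e (Sum.inl k)).succ) * β (fun k => u (e (Sum.inr k)).succ)
  have h1 : ∑ i : Fin (n + 1), (-1 : ℝ) ^ (i : ℕ) * wedge e (D (v i)) β (i.removeNth v) =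
      ∑ τ : Equiv.Perm (Fin (n + 1)), ((Equiv.Perm.sign τ : ℤ) : ℝ) * F (v ∘ τ) := by
    rw [← sum_removeNth_sum_perm]
    simp only [wedge_apply, F, Fin.cons_zero, Fin.cons_succ]
  have h2 : wedge e₁ (AlternatingMap.alternatizeUncurryFin D) β v =
      ∑ i : Fin (p + 1), (-1 : ℝ) ^ (i : ℕ) * ∑ τ : Equiv.Perm (Fin (n + 1)),
        ((Equiv.Perm.sign τ : ℤ) : ℝ) * F (v ∘ τ ∘ c i) := by
    simp_rw [Finset.mul_sum]
    rw [wedge_apply, Finset.sum_comm]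
    refine Finset.sum_congr rfl fun τ _ => ?_
    rw [AlternatingMap.alternatizeUncurryFin_apply, Finset.sum_mul, Finset.mul_sum]
    refine Finset.sum_congr rfl fun i _ => ?_
    have g0 : c i 0 = e₁ (Sum.inl i) := by
      have := hc i (Sum.inl 0)
      simpa [f₀, s] using this
    have g1 : ∀ k, c i (e (Sum.inl k)).succ = e₁ (Sum.inl (i.succAbove k)) := fun k => by
      have := hc i (Sum.inl k.succ)
      simpa [f₀, s] using this
    have g2 : ∀ k, c i (e (Sum.inr k)).succ = e₁ (Sum.inr k) := fun k => by
      have := hc i (Sum.inr k)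
      simpa [f₀, s] using this
    simp only [F, Function.comp_apply, g0, g1, g2, zsmul_eq_mul, Int.cast_pow, Int.cast_neg,
      Int.cast_one]
    change _ * ((-1) ^ (i : ℕ) * D (v (τ (e₁ (Sum.inl i))))
      (fun k => v (τ (e₁ (Sum.inl (i.succAbove k))))) * _) = _
    ring
  rw [h1, h2]
  simp_rw [sum_sign_comp, ← mul_assoc, hsign]
  rw [Finset.sum_const, Finset.card_univ, Fintype.card_fin, nsmul_eq_mul]
  push_cast
  field_simp
  rw [pow_two, hsq, mul_one]

end Wedge

/-! ### The Leibniz rule for the differential -/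

section Leibniz

variable {𝔤 : Type*} [LieRing 𝔤] [LieAlgebra ℝ 𝔤] {p q n : ℕ}

/-- Under each permutation every argument feeds exactly one of the two factors, so the sum over
arguments splits. -/
theorem lieDer_wedge (e : Fin p ⊕ Fin q ≃ Fin n) (x : 𝔤) (α : 𝔤 [⋀^Fin p]→ₗ[ℝ] ℝ)
    (β : 𝔤 [⋀^Fin q]→ₗ[ℝ] ℝ) :
    lieDer x (wedge e α β) = wedge e (lieDer x α) β + wedge e α (lieDer x β) := by
  ext v
  rw [lieDer_apply, AlternatingMap.add_apply, wedge_apply, wedge_apply, ← Finset.sum_add_distrib]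
  simp_rw [wedge_apply]
  rw [Finset.sum_comm, ← Finset.sum_neg_distrib]
  refine Finset.sum_congr rfl fun σ _ => ?_
  rw [← Finset.mul_sum, ← mul_neg, ← mul_add]
  congr 1
  rw [← (e.trans σ).sum_comp, Fintype.sum_sum_type, neg_add, lieDer_apply, lieDer_apply, neg_mul,
    mul_neg, Finset.sum_mul, Finset.mul_sum]
  have hne : ∀ {a b : Fin p ⊕ Fin q}, a ≠ b → σ (e a) ≠ σ (e b) := fun h h' =>
    h (e.injective (σ.injective h'))
  congr 2
  · refine Finset.sum_congr rfl fun k _ => ?_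
    congr 2
    · funext i
      by_cases h : i = k
      · subst h; simp
      · rw [Function.update_of_ne h]
        exact Function.update_of_ne (hne fun h' => h (Sum.inl_injective h')) _ _
    · funext i
      rw [Equiv.trans_apply, Function.update_of_ne (hne (by simp))]
  · refine Finset.sum_congr rfl fun k _ => ?_
    congr 2
    · funext i
      rw [Equiv.trans_apply, Function.update_of_ne (hne (by simp))]
    · funext i
      by_cases h : i = k
      · subst h; simp
      · rw [Function.update_of_ne h]
        exact Function.update_of_ne (hne fun h' => h (Sum.inr_injective h')) _ _

theorem ceDiff_eq (α : 𝔤 [⋀^Fin p]→ₗ[ℝ] ℝ) : AlternatingMap.alternatizeUncurryFin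
    ((lieDerLM p).flip α) = (2 : ℝ) • ceDiff p α := by
  rw [ceDiff, LinearMap.smul_apply, smul_smul]
  norm_num

/-- The Leibniz rule, up to nonzero factors depending on normalizations only. -/
theorem exists_ceDiff_wedge (e : Fin p ⊕ Fin q ≃ Fin n)
    (e₁ : Fin (p + 1) ⊕ Fin q ≃ Fin (n + 1)) (e₂ : Fin p ⊕ Fin (q + 1) ≃ Fin (n + 1)) :
    ∃ a b : ℝ, a ≠ 0 ∧ b ≠ 0 ∧ ∀ (α : 𝔤 [⋀^Fin p]→ₗ[ℝ] ℝ) (β : 𝔤 [⋀^Fin q]→ₗ[ℝ] ℝ),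
      ceDiff n (wedge e α β) = a • wedge e₁ (ceDiff p α) β + b • wedge e₂ α (ceDiff q β) := by
  obtain ⟨a, ha, h1⟩ := exists_wedge_alternatizeUncurryFin (W := 𝔤) e e₁
  obtain ⟨b, hb, h2⟩ := exists_wedge_alternatizeUncurryFin (W := 𝔤)
    ((Equiv.sumComm (Fin q) (Fin p)).trans e) ((Equiv.sumComm (Fin (q + 1)) (Fin p)).trans e₂)
  refine ⟨a, b, ha, hb, fun α β => ?_⟩
  ext v
  have g1 := h1 ((lieDerLM p).flip α) β v
  have g2 := h2 ((lieDerLM q).flip β) α v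
  rw [ceDiff_eq, wedge_smul_left, AlternatingMap.smul_apply, smul_eq_mul] at g1 g2
  rw [← wedge_comm] at g2
  rw [ceDiff_apply, AlternatingMap.add_apply, AlternatingMap.smul_apply, AlternatingMap.smul_apply,
    smul_eq_mul, smul_eq_mul]
  have g3 : ∀ i : Fin (n + 1), (-1 : ℝ) ^ (i : ℕ) * lieDer (v i) (wedge e α β) (i.removeNth v) =
      (-1 : ℝ) ^ (i : ℕ) * wedge e ((lieDerLM p).flip α (v i)) β (i.removeNth v) +
      (-1 : ℝ) ^ (i : ℕ) * wedge ((Equiv.sumComm (Fin q) (Fin p)).trans e)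
        ((lieDerLM q).flip β (v i)) α (i.removeNth v) := fun i => by
    rw [lieDer_wedge, AlternatingMap.add_apply, mul_add, wedge_comm e α]
    rfl
  simp_rw [g3]
  rw [Finset.sum_add_distrib, g1, g2]
  ring

variable {𝔥 : LieSubalgebra ℝ 𝔤}

theorem wedge_mem_horForm (e : Fin p ⊕ Fin q ≃ Fin n) {α : 𝔤 [⋀^Fin p]→ₗ[ℝ] ℝ}
    {β : 𝔤 [⋀^Fin q]→ₗ[ℝ] ℝ} (hα : α ∈ horForm 𝔥 p) (hβ : β ∈ horForm 𝔥 q) :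
    wedge e α β ∈ horForm 𝔥 n := by
  rintro v ⟨i, hi⟩
  rw [wedge_apply]
  refine Finset.sum_eq_zero fun σ _ => ?_
  obtain ⟨k, rfl⟩ := (e.trans σ).surjective i
  rcases k with k | k
  · rw [hα _ ⟨k, hi⟩, zero_mul, mul_zero]
  · rw [hβ _ ⟨k, hi⟩, mul_zero, mul_zero]

theorem wedge_mem_relCochain (e : Fin p ⊕ Fin q ≃ Fin n) {α : 𝔤 [⋀^Fin p]→ₗ[ℝ] ℝ}
    {β : 𝔤 [⋀^Fin q]→ₗ[ℝ] ℝ} (hα : α ∈ relCochain 𝔥 p) (hβ : β ∈ relCochain 𝔥 q) :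
    wedge e α β ∈ relCochain 𝔥 n := by
  refine ⟨wedge_mem_horForm e hα.1 hβ.1, fun x hx => ?_⟩
  rw [lieDer_wedge, hα.2 x hx, hβ.2 x hx, ← wedgeLM_apply, ← wedgeLM_apply, map_zero, map_zero,
    LinearMap.zero_apply, add_zero]

end Leibniz

/-! ### Frames of `𝔤/𝔥`, volume form and wedge pairing -/

section Frame

variable {𝔤 : Type*} [LieRing 𝔤] [LieAlgebra ℝ 𝔤]

/-- If a bilinear form is left-separating, every functional on the left is represented on the
right. -/
theorem exists_forall_apply_eq {U V : Type*} [AddCommGroup U] [Module ℝ U] [AddCommGroup V]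
    [Module ℝ V] [hV : FiniteDimensional ℝ V] (B : U →ₗ[ℝ] V →ₗ[ℝ] ℝ)
    (hB : ∀ u, u ≠ 0 → ∃ v, B u v ≠ 0) (φ : U →ₗ[ℝ] ℝ) : ∃ v, ∀ u, B u v = φ u := by
  have hinj : Function.Injective (show U →ₗ[ℝ] Module.Dual ℝ V from B) := by
    rw [injective_iff_map_eq_zero]
    intro u hu
    by_contra h0
    obtain ⟨v, hv⟩ := hB u h0
    exact hv (LinearMap.congr_fun hu v)
  obtain ⟨ψ, hψ⟩ := LinearMap.dualMap_surjective_of_injective hinj φ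
  obtain ⟨v, rfl⟩ := (Module.evalEquiv ℝ V).surjective ψ
  exact ⟨v, fun u => LinearMap.congr_fun hψ u⟩

/-- Evaluation of alternating forms at given arguments. -/
def evalForm {p : ℕ} (v : Fin p → 𝔤) : (𝔤 [⋀^Fin p]→ₗ[ℝ] ℝ) →ₗ[ℝ] ℝ where
  toFun α := α v
  map_add' _ _ := rfl
  map_smul' _ _ := rfl

/-- Vectors `e i` and dual linear forms `c i` giving a basis of `𝔤 ⧸ 𝔥`. -/
structure DualFrame (𝔥 : LieSubalgebra ℝ 𝔤) (N : ℕ) where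
  e : Fin N → 𝔤
  c : Fin N → 𝔤 →ₗ[ℝ] ℝ
  c_e : ∀ i j, c i (e j) = if i = j then 1 else 0
  c_mem : ∀ i, ∀ x ∈ 𝔥, c i x = 0
  sub_mem : ∀ x, x - ∑ j, c j x • e j ∈ 𝔥

namespace DualFrame

variable {𝔥 : LieSubalgebra ℝ 𝔤} {N p q n : ℕ} (F : DualFrame 𝔥 N)

theorem map_update {α : 𝔤 [⋀^Fin p]→ₗ[ℝ] ℝ} (hα : α ∈ horForm 𝔥 p) (v : Fin p → 𝔤) (i : Fin p)
    (x : 𝔤) : α (Function.update v i x) = ∑ j, F.c j x * α (Function.update v i (F.e j)) := by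
  have h1 : α (Function.update v i (x - ∑ j, F.c j x • F.e j)) = 0 :=
    hα _ ⟨i, by rw [Function.update_self]; exact F.sub_mem x⟩
  rw [AlternatingMap.map_update_sub, sub_eq_zero, AlternatingMap.map_update_sum] at h1
  rw [h1]
  exact Finset.sum_congr rfl fun j _ => AlternatingMap.map_update_smul _ _ _ _ _

/-- Modulo `𝔥` each argument may be replaced, one at a time, by its frame expansion, so a horizontal
form is pulled back from an alternating form on `ℝᴺ`. -/
theorem ext_horForm {α β : 𝔤 [⋀^Fin p]→ₗ[ℝ] ℝ} (hα : α ∈ horForm 𝔥 p) (hβ : β ∈ horForm 𝔥 p)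
    (h : ∀ f : Fin p → Fin N, Function.Injective f → α (F.e ∘ f) = β (F.e ∘ f)) : α = β := by
  let l : (Fin N → ℝ) →ₗ[ℝ] 𝔤 := Fintype.linearCombination ℝ F.e
  have hl : ∀ j, l (Pi.basisFun ℝ (Fin N) j) = F.e j := fun j => by
    simp [l, Fintype.linearCombination_apply_single]
  have h1 : α.compLinearMap l = β.compLinearMap l := by
    refine (Pi.basisFun ℝ (Fin N)).ext_alternating fun f hf => ?_
    simp only [AlternatingMap.compLinearMap_apply, hl]
    exact h f hf
  have key : ∀ γ : 𝔤 [⋀^Fin p]→ₗ[ℝ] ℝ, γ ∈ horForm 𝔥 p → ∀ v,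
      γ v = γ.compLinearMap l (fun i j => F.c j (v i)) := fun γ hγ v => by
    have h2 : ∀ s : Finset (Fin p), γ (s.piecewise (fun i => ∑ j, F.c j (v i) • F.e j) v) = γ v := by
      intro s
      induction s using Finset.induction_on with
      | empty => simp
      | insert i s hi ih =>
        rw [Finset.piecewise_insert, ← ih]
        have h3 := F.map_update hγ (s.piecewise (fun i => ∑ j, F.c j (v i) • F.e j) v) i
        have h4 : v i = s.piecewise (fun i => ∑ j, F.c j (v i) • F.e j) v i :=
          (Finset.piecewise_eq_of_notMem _ _ _ hi).symm
        conv_rhs => rw [← Function.update_eq_self i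
          (s.piecewise (fun i => ∑ j, F.c j (v i) • F.e j) v), ← h4]
        rw [h3, h3]
        refine Finset.sum_congr rfl fun k _ => ?_
        congr 1
        rw [map_sum]
        simp [F.c_e]
    rw [← h2 Finset.univ, Finset.piecewise_univ, AlternatingMap.compLinearMap_apply]
    rfl
  ext v
  rw [key α hα, key β hβ, h1]

theorem ext_top {α β : 𝔤 [⋀^Fin N]→ₗ[ℝ] ℝ} (hα : α ∈ horForm 𝔥 N) (hβ : β ∈ horForm 𝔥 N)
    (h : α F.e = β F.e) : α = β := by
  refine F.ext_horForm hα hβ fun f hf => ?_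
  let σ := Equiv.ofBijective f (Finite.injective_iff_bijective.mp hf)
  have h1 := α.map_perm F.e σ
  have h2 := β.map_perm F.e σ
  rw [h, ← h2] at h1
  exact h1

theorem eq_zero_of_lt (F : DualFrame 𝔥 N) {α : 𝔤 [⋀^Fin p]→ₗ[ℝ] ℝ} (hα : α ∈ horForm 𝔥 p) (h : N < p) : α = 0 := by
  refine F.ext_horForm hα (Submodule.zero_mem _) fun f hf => ?_
  have := Fintype.card_le_of_injective f hf
  simp only [Fintype.card_fin] at this
  omega

/-- Off-diagonal coefficients of `ad y` repeat a frame vector and drop out; what remains is minus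
the trace of the frame block of `ad y`, for any `y ∈ 𝔤`. -/
theorem lieDer_apply_e {α : 𝔤 [⋀^Fin N]→ₗ[ℝ] ℝ} (hα : α ∈ horForm 𝔥 N) (y : 𝔤) :
    lieDer y α F.e = -(∑ j, F.c j ⁅y, F.e j⁆) * α F.e := by
  rw [lieDer_apply, neg_mul, Finset.sum_mul]
  congr 1
  refine Finset.sum_congr rfl fun j _ => ?_
  rw [F.map_update hα, Finset.sum_eq_single j]
  · rw [Function.update_eq_self]
  · intro k _ hk
    rw [α.map_eq_zero_of_eq (i := j) (j := k) _ ?_ (Ne.symm hk), mul_zero]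
    rw [Function.update_self, Function.update_of_ne hk]
  · simp

/-- The horizontal volume form of a frame. -/
noncomputable def vol : 𝔤 [⋀^Fin N]→ₗ[ℝ] ℝ :=
  Matrix.detRowAlternating.compLinearMap (LinearMap.pi F.c)

theorem vol_mem : F.vol ∈ horForm 𝔥 N := by
  rintro v ⟨i, hi⟩
  change Matrix.det (fun i j => F.c j (v i)) = 0
  exact Matrix.det_eq_zero_of_row_eq_zero i fun j => F.c_mem j _ hi

theorem vol_e : F.vol F.e = 1 := by
  change Matrix.det (Matrix.of fun i j => F.c j (F.e i)) = 1
  convert Matrix.det_one (n := Fin N) (R := ℝ) using 2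
  ext i j
  rw [Matrix.of_apply, F.c_e, Matrix.one_apply]
  simp [eq_comm]

theorem exists_wedge_ne_zero (E : Fin p ⊕ Fin q ≃ Fin N) {α : 𝔤 [⋀^Fin p]→ₗ[ℝ] ℝ}
    (hα : α ∈ horForm 𝔥 p) (h0 : α ≠ 0) : ∃ β ∈ horForm 𝔥 q, wedge E α β F.e ≠ 0 := by
  obtain ⟨f, hf, hαf⟩ : ∃ f : Fin p → Fin N, Function.Injective f ∧ α (F.e ∘ f) ≠ 0 := by
    by_contra! h
    exact h0 (F.ext_horForm hα (Submodule.zero_mem _) h)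
  obtain ⟨E', hE'⟩ : ∃ E' : Fin p ⊕ Fin q ≃ Fin N, ∀ i, E' (Sum.inl i) = f i := by
    classical
    have hcard : Fintype.card (Fin q) = Fintype.card ↥(Set.range f)ᶜ := by
      have h1 := Fintype.card_congr E
      have h2 := Fintype.card_congr (Equiv.Set.sumCompl (Set.range f))
      have h3 := Set.card_range_of_injective hf
      rw [Fintype.card_sum] at h1 h2
      omega
    exact ⟨((Equiv.sumCongr (Equiv.ofInjective f hf) (Fintype.equivOfCardEq hcard)).trans
      (Equiv.Set.sumCompl (Set.range f))), fun i => by simp⟩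
  -- The determinant form in the frame directions not hit by `f`.
  let β : 𝔤 [⋀^Fin q]→ₗ[ℝ] ℝ :=
    Matrix.detRowAlternating.compLinearMap (LinearMap.pi fun j => F.c (E' (Sum.inr j)))
  have hβ : ∀ w, β w = Matrix.det (Matrix.of fun i j => F.c (E' (Sum.inr j)) (w i)) := fun w => rfl
  have hβ1 : β (fun i => F.e (E' (Sum.inr i))) = 1 := by
    rw [hβ]
    convert Matrix.det_one (n := Fin q) (R := ℝ) using 2
    ext i j
    rw [Matrix.of_apply, F.c_e, Matrix.one_apply]
    simp [eq_comm]
  refine ⟨β, ?_, fun hzero => ?_⟩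
  · rintro v ⟨i, hi⟩
    rw [hβ]
    exact Matrix.det_eq_zero_of_row_eq_zero i fun j => F.c_mem _ _ hi
  · let τ : Equiv.Perm (Fin N) := E.symm.trans E'
    have h1 : wedge E α β (F.e ∘ τ) = 0 := by
      rw [AlternatingMap.map_perm, hzero, smul_zero]
    rw [wedge_apply] at h1
    classical
    -- Permutations preserving the two blocks all contribute `α (F.e ∘ f)`, their signs cancelling.
    -- Any other feeds `β` a vector of the first block, giving a zero row. The identity shows that
    -- the count is positive.
    have h2 : ∀ σ : Equiv.Perm (Fin N), ((Equiv.Perm.sign σ : ℤ) : ℝ) *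
        (α (fun i => (F.e ∘ τ) (σ (E (Sum.inl i)))) *
          β (fun i => (F.e ∘ τ) (σ (E (Sum.inr i))))) =
        if Set.MapsTo (E.symm.permCongr σ) (Set.range Sum.inl) (Set.range Sum.inl) then
          α (F.e ∘ f) else 0 := fun σ => by
      set s : Equiv.Perm (Fin p ⊕ Fin q) := E.symm.permCongr σ with hs
      have hτ : ∀ x, (F.e ∘ τ) (σ (E x)) = F.e (E' (s x)) := fun x => by simp [τ, hs]
      have hsign : Equiv.Perm.sign σ = Equiv.Perm.sign s := by simp [hs]
      simp_rw [hτ]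
      split_ifs with hm
      · obtain ⟨⟨s₁, s₂⟩, hs12⟩ := Equiv.Perm.mem_sumCongrHom_range_of_perm_mapsTo_inl hm
        have hl : ∀ i, s (Sum.inl i) = Sum.inl (s₁ i) := fun i => by rw [← hs12]; simp
        have hr : ∀ i, s (Sum.inr i) = Sum.inr (s₂ i) := fun i => by rw [← hs12]; simp
        have hsg : Equiv.Perm.sign s = Equiv.Perm.sign s₁ * Equiv.Perm.sign s₂ := by
          rw [← hs12]; simp
        simp_rw [hl, hr, hE']
        have g1 := α.map_perm (F.e ∘ f) s₁
        have g2 := β.map_perm (fun i => F.e (E' (Sum.inr i))) s₂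
        rw [Units.smul_def, zsmul_eq_mul] at g1 g2
        rw [hβ1, mul_one] at g2
        have g3 : ∀ u : ℤˣ, ((u : ℤ) : ℝ) * ((u : ℤ) : ℝ) = 1 := fun u => by
          rw [← Int.cast_mul, ← Units.val_mul, Int.units_mul_self]; simp
        change _ * (α ((F.e ∘ f) ∘ s₁) * β ((fun i => F.e (E' (Sum.inr i))) ∘ s₂)) = _
        rw [g1, g2, hsign, hsg, Units.val_mul, Int.cast_mul]
        linear_combination (((Equiv.Perm.sign s₂ : ℤ) : ℝ) * ((Equiv.Perm.sign s₂ : ℤ) : ℝ) *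
          α (F.e ∘ f)) * g3 (Equiv.Perm.sign s₁) + α (F.e ∘ f) * g3 (Equiv.Perm.sign s₂)
      · rw [Equiv.Perm.perm_mapsTo_inl_iff_mapsTo_inr] at hm
        obtain ⟨_, ⟨i, rfl⟩, hi⟩ :
            ∃ x ∈ Set.range Sum.inr, s x ∉ (Set.range Sum.inr : Set (Fin p ⊕ Fin q)) := by
          by_contra! h
          exact hm h
        obtain ⟨k, hk⟩ : ∃ k, s (Sum.inr i) = Sum.inl k := by
          rcases hsi : s (Sum.inr i) with k | k
          · exact ⟨k, rfl⟩
          · exact absurd ⟨k, hsi.symm⟩ hi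
        rw [hβ, Matrix.det_eq_zero_of_row_eq_zero i fun j => ?_, mul_zero, mul_zero]
        rw [Matrix.of_apply, hk, F.c_e, if_neg]
        intro h
        simpa using E'.injective h
    rw [Finset.sum_congr rfl fun σ _ => h2 σ, ← Finset.sum_filter, Finset.sum_const,
      nsmul_eq_mul, mul_eq_zero, or_iff_left hαf, Nat.cast_eq_zero, Finset.card_eq_zero,
      Finset.filter_eq_empty_iff] at h1
    refine h1 (Finset.mem_univ 1) ?_
    rintro _ ⟨i, rfl⟩
    exact ⟨i, by simp⟩

/-- An injective choice of `n` frame vectors omits exactly one index `i`, and against it `ι_(e_j)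
vol` vanishes unless `j = i`. The coefficient of `e_i` can therefore be read off from `θ`. -/
theorem exists_curryLeft_vol {n : ℕ} (F : DualFrame 𝔥 (n + 1)) {θ : 𝔤 [⋀^Fin n]→ₗ[ℝ] ℝ}
    (hθ : θ ∈ horForm 𝔥 n) : ∃ y, F.vol.curryLeft y = θ := by
  refine ⟨∑ j : Fin (n + 1), ((-1) ^ (j : ℕ) * θ (j.removeNth F.e)) • F.e j, ?_⟩
  refine F.ext_horForm (fun v ⟨i, hi⟩ => F.vol_mem _ ⟨i.succ, by simpa using hi⟩) hθ fun f hf => ?_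
  obtain ⟨i, hi⟩ : ∃ i, ∀ k, f k ≠ i := by
    by_contra! h
    have := Fintype.card_le_of_surjective f h
    simp at this
  choose σ hσ using fun k => Fin.exists_succAbove_eq (hi k)
  have hσi : Function.Injective σ := fun a b hab => hf (by rw [← hσ a, ← hσ b, hab])
  let s := Equiv.ofBijective σ (Finite.injective_iff_bijective.mp hσi)
  have hfe : F.e ∘ f = i.removeNth F.e ∘ s := by
    funext k
    change F.e (f k) = F.e (i.succAbove (σ k))
    rw [hσ]
  rw [hfe, AlternatingMap.map_perm, AlternatingMap.map_perm]
  congr 1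
  change (evalForm (i.removeNth F.e) ∘ₗ F.vol.curryLeft) _ = _
  rw [map_sum, Finset.sum_eq_single i]
  · have h1 := F.vol.map_insertNth i (F.e i) (i.removeNth F.e)
    rw [Fin.insertNth_self_removeNth, F.vol_e, zsmul_eq_mul] at h1
    rw [map_smul, smul_eq_mul]
    change _ * F.vol (Matrix.vecCons (F.e i) (i.removeNth F.e)) = _
    change _ = _ * F.vol (Matrix.vecCons (F.e i) (i.removeNth F.e)) at h1
    push_cast at h1
    linear_combination -(θ (i.removeNth F.e)) * h1
  · intro j _ hj
    obtain ⟨k, hk⟩ := Fin.exists_succAbove_eq hj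
    rw [map_smul, LinearMap.comp_apply]
    change _ • F.vol (Matrix.vecCons (F.e j) (i.removeNth F.e)) = 0
    rw [F.vol.map_eq_zero_of_eq (i := 0) (j := k.succ) _ ?_ (Fin.succ_ne_zero k).symm, smul_zero]
    rw [Matrix.cons_val_zero, Matrix.cons_val_succ, Fin.removeNth, hk]
  · simp

section Unimodular

theorem horForm_top_le (hT : ∀ y : 𝔤, ∑ j, F.c j ⁅y, F.e j⁆ = 0) : horForm 𝔥 N ≤ relCochain 𝔥 N := fun α hα =>
  ⟨hα, fun x hx => F.ext_top (lieDer_mem_horForm hα hx) (Submodule.zero_mem _) (by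
    rw [F.lieDer_apply_e hα, hT]; simp)⟩

/-- In the unimodular case, relative coboundaries of top degree vanish. -/
theorem ceDiff_eq_zero {n : ℕ} (F : DualFrame 𝔥 (n + 1))
    (hT : ∀ y : 𝔤, ∑ j, F.c j ⁅y, F.e j⁆ = 0) {θ : 𝔤 [⋀^Fin n]→ₗ[ℝ] ℝ}
    (hθ : θ ∈ relCochain 𝔥 n) : ceDiff n θ = 0 := by
  refine F.ext_top (ceDiff_mem_relCochain hθ).1 (Submodule.zero_mem _) ?_
  -- With `θ = ι_y vol`, `dθ = ℒ_y vol - ι_y d vol`. Here `d vol` is horizontal of degree above `N`,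
  -- hence zero, and `ℒ_y vol` is a trace that vanishes. Note that `y` need not lie in `𝔥`.
  obtain ⟨y, rfl⟩ := F.exists_curryLeft_vol hθ.1
  have h1 := curryLeft_ceDiff y F.vol
  rw [F.eq_zero_of_lt (ceDiff_mem_relCochain (F.horForm_top_le hT F.vol_mem)).1 (by omega),
    AlternatingMap.curryLeft_zero, LinearMap.zero_apply, eq_comm, sub_eq_zero] at h1
  rw [← h1, F.lieDer_apply_e F.vol_mem, hT]
  simp

variable [FiniteDimensional ℝ 𝔤]

/-- Nondegeneracy of the wedge pairing on relative cochains. -/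
theorem exists_relCochain_wedge_ne_zero (hT : ∀ y : 𝔤, ∑ j, F.c j ⁅y, F.e j⁆ = 0)
    (hred : IsReductiveIn 𝔥) (E : Fin p ⊕ Fin q ≃ Fin N)
    {α : 𝔤 [⋀^Fin p]→ₗ[ℝ] ℝ} (hα : α ∈ relCochain 𝔥 p) (h0 : α ≠ 0) :
    ∃ β ∈ relCochain 𝔥 q, wedge E α β F.e ≠ 0 := by
  obtain ⟨β', hβ', hne⟩ := F.exists_wedge_ne_zero E hα.1 h0
  obtain ⟨β, hβ, hsub⟩ := hred.horForm_decomposition hβ'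
  refine ⟨β, hβ, ?_⟩
  -- Passing to the invariant part `β` does not change the pairing: `α ∧ ℒ_x δ = ℒ_x (α ∧ δ)`, and
  -- `𝔥` kills top horizontal forms.
  suffices wedge E α (β' - β) = 0 by
    rw [← wedgeLM_apply, map_sub, sub_eq_zero, wedgeLM_apply, wedgeLM_apply] at this
    rwa [← this]
  refine LinearMap.mem_ker.mp ((Submodule.span_le (p := LinearMap.ker (wedgeLM E α))).mpr ?_ hsub)
  rintro _ ⟨x, hx, δ, hδ, rfl⟩
  have h1 := lieDer_wedge E x α δ
  rw [hα.2 x hx, (F.horForm_top_le hT (wedge_mem_horForm E hα.1 hδ)).2 x hx, ← wedgeLM_apply,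
    map_zero, LinearMap.zero_apply, zero_add] at h1
  exact h1.symm

/-- Every functional on relative cochains is the wedge pairing with a relative cochain. -/
theorem exists_wedge_eq (hT : ∀ y : 𝔤, ∑ j, F.c j ⁅y, F.e j⁆ = 0)
    (hred : IsReductiveIn 𝔥) (E : Fin p ⊕ Fin q ≃ Fin N)
    (φ : (𝔤 [⋀^Fin p]→ₗ[ℝ] ℝ) →ₗ[ℝ] ℝ) :
    ∃ β ∈ relCochain 𝔥 q, ∀ γ ∈ relCochain 𝔥 p, wedge E γ β F.e = φ γ := by
  have := finiteDimensional_alternatingMap (𝔤 := 𝔤) q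
  have : FiniteDimensional ℝ (relCochain 𝔥 q) := FiniteDimensional.finiteDimensional_submodule _
  have hsep : ∀ α : relCochain 𝔥 p, α ≠ 0 → ∃ β : relCochain 𝔥 q, wedge E α β F.e ≠ 0 := by
    intro α h0
    obtain ⟨β, hβ, hne⟩ := F.exists_relCochain_wedge_ne_zero hT hred E α.2
      (fun h => h0 (Submodule.coe_eq_zero.mp h))
    exact ⟨⟨β, hβ⟩, hne⟩
  obtain ⟨β, hβ⟩ := exists_forall_apply_eq (U := relCochain 𝔥 p) (V := relCochain 𝔥 q) (((wedgeLM E).compr₂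
    (evalForm F.e)).domRestrict₁₂ (relCochain 𝔥 p) (relCochain 𝔥 q)) hsep
    (φ.domRestrict (relCochain 𝔥 p))
  exact ⟨β, β.2, fun γ hγ => hβ ⟨γ, hγ⟩⟩

end Unimodular

end DualFrame

variable [FiniteDimensional ℝ 𝔤] {𝔥 : LieSubalgebra ℝ 𝔤}

/-- A reductive subalgebra of a unimodular Lie algebra admits a frame on which all brackets are
trace-free. -/
theorem IsReductiveIn.exists_dualFrame (hred : IsReductiveIn 𝔥) (hG : AdTraceFree 𝔤) :
    ∃ F : DualFrame 𝔥 (codim 𝔥), ∀ y : 𝔤, ∑ j, F.c j ⁅y, F.e j⁆ = 0 := by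
  have : ComplementedLattice (LieSubmodule ℝ 𝔥 𝔤) := hred
  obtain ⟨C, hC⟩ := exists_isCompl (𝔥.toLieSubmodule)
  have hc : IsCompl 𝔥.toSubmodule C.toSubmodule := by
    have := (LieSubmodule.isCompl_toSubmodule).mpr hC
    exact this
  have hdim : Module.finrank ℝ C.toSubmodule = codim 𝔥 :=
    (Submodule.quotientEquivOfIsCompl _ _ hc).finrank_eq.symm
  let b := Module.finBasisOfFinrankEq ℝ C.toSubmodule hdim
  let π := C.toSubmodule.projectionOnto 𝔥.toSubmodule hc.symm
  let π' := 𝔥.toSubmodule.projectionOnto C.toSubmodule hc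
  have hsum : ∀ x : 𝔤, (π' x : 𝔤) + π x = x := fun x =>
    Submodule.projection_add_projection_eq_self hc x
  refine ⟨⟨fun i => b i, fun i => b.coord i ∘ₗ π, fun i j => ?_, fun i x hx => ?_, fun x => ?_⟩,
    fun y => ?_⟩
  · rw [LinearMap.comp_apply, Submodule.projectionOnto_apply_left, Module.Basis.coord_apply,
      Module.Basis.repr_self, Finsupp.single_apply]
    simp [eq_comm]
  · rw [LinearMap.comp_apply, show π x = 0 from
      (Submodule.projectionOnto_apply_eq_zero_iff _).mpr hx, map_zero]
  · have h1 : ∑ j, b.coord j (π x) • (b j : 𝔤) = π x := by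
      have := congrArg Subtype.val (b.sum_repr (π x))
      rw [Submodule.coe_sum] at this
      exact this
    have h2 : x - ∑ j, b.coord j (π x) • (b j : 𝔤) = π' x := by
      rw [h1, sub_eq_iff_eq_add, hsum]
    exact h2 ▸ (π' x).2
  · have hm : ∑ j, (b.coord j ∘ₗ π) ⁅y, (b j : 𝔤)⁆ = LinearMap.trace ℝ C.toSubmodule
        (π ∘ₗ (LieAlgebra.ad ℝ 𝔤 y : Module.End ℝ 𝔤) ∘ₗ C.toSubmodule.subtype) := by
      rw [LinearMap.trace_eq_matrix_trace ℝ b, Matrix.trace]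
      refine Finset.sum_congr rfl fun j _ => ?_
      rw [Matrix.diag_apply, LinearMap.toMatrix_apply]
      rfl
    refine hm.trans ?_
    -- As `[C, 𝔥] ⊆ C`, the `𝔥`-block of `ad y` is `ad` of the `𝔥`-component of `y`, trace-free by
    -- unimodularity of `𝔥`. The full trace is zero, so the `C`-block is trace-free too.
    have hh : LinearMap.trace ℝ 𝔥.toSubmodule
        (π' ∘ₗ (LieAlgebra.ad ℝ 𝔤 y : Module.End ℝ 𝔤) ∘ₗ 𝔥.toSubmodule.subtype) = 0 := by
      have hy : π' ∘ₗ (LieAlgebra.ad ℝ 𝔤 y : Module.End ℝ 𝔤) ∘ₗ 𝔥.toSubmodule.subtype =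
          (LieAlgebra.ad ℝ 𝔥 (π' y) : Module.End ℝ 𝔥) := by
        refine LinearMap.ext fun w => ?_
        have h1 : ⁅y, (w : 𝔤)⁆ = ⁅(π' y : 𝔤), (w : 𝔤)⁆ + ⁅(π y : 𝔤), (w : 𝔤)⁆ := by
          rw [← add_lie, hsum]
        have h2 : ⁅(π y : 𝔤), (w : 𝔤)⁆ ∈ C.toSubmodule := by
          rw [← lie_skew]
          exact Submodule.neg_mem _ (C.lie_mem (x := w) (π y).2)
        change π' ⁅y, (w : 𝔤)⁆ = _
        rw [h1, map_add, show π' ⁅(π y : 𝔤), (w : 𝔤)⁆ = 0 from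
          (Submodule.projectionOnto_apply_eq_zero_iff _).mpr h2, add_zero]
        exact Submodule.projectionOnto_apply_left hc ⟨_, 𝔥.lie_mem (π' y).2 w.2⟩
      rw [hy]
      exact hred.adTraceFree (π' y)
    have e1 := LinearMap.trace_comp_comm' (R := ℝ) C.toSubmodule.subtype
      (π ∘ₗ (LieAlgebra.ad ℝ 𝔤 y : Module.End ℝ 𝔤))
    have e2 := LinearMap.trace_comp_comm' (R := ℝ) 𝔥.toSubmodule.subtype
      (π' ∘ₗ (LieAlgebra.ad ℝ 𝔤 y : Module.End ℝ 𝔤))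
    rw [LinearMap.comp_assoc] at e1 e2
    rw [e1]
    rw [hh] at e2
    have e3 := hG y
    have e4 : (LieAlgebra.ad ℝ 𝔤 y : Module.End ℝ 𝔤) =
        𝔥.toSubmodule.subtype ∘ₗ π' ∘ₗ (LieAlgebra.ad ℝ 𝔤 y : Module.End ℝ 𝔤) +
        C.toSubmodule.subtype ∘ₗ π ∘ₗ (LieAlgebra.ad ℝ 𝔤 y : Module.End ℝ 𝔤) := by
      refine LinearMap.ext fun w => (hsum _).symm
    rw [e4, map_add, ← e2, zero_add] at e3
    exact e3

end Frame

/-! ### Injectivity below the top degree by duality -/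

section Duality

variable {𝔤 : Type*} [LieRing 𝔤] [LieAlgebra ℝ 𝔤] {𝔥 𝔨 : LieSubalgebra ℝ 𝔤}

theorem injective_subquotientMap_iff {V : Type*} [AddCommGroup V] [Module ℝ V]
    {Z B Z' B' : Submodule ℝ V} (hZ : Z ≤ Z') (hB : B ≤ B') :
    Function.Injective (subquotientMap hZ hB) ↔ ∀ z ∈ Z, z ∈ B' → z ∈ B := by
  have hker : ∀ z : Z, subquotientMap hZ hB (Submodule.Quotient.mk z) = 0 ↔ (z : V) ∈ B' :=
    fun z => Submodule.Quotient.mk_eq_zero (B'.submoduleOf Z')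
  have hker' : ∀ z : Z, (Submodule.Quotient.mk z : Subquotient Z B) = 0 ↔ (z : V) ∈ B :=
    fun z => Submodule.Quotient.mk_eq_zero (B.submoduleOf Z)
  rw [injective_iff_map_eq_zero]
  constructor
  · intro hi z hz hzB
    exact (hker' ⟨z, hz⟩).mp (hi _ ((hker ⟨z, hz⟩).mpr hzB))
  · intro hi x hx
    obtain ⟨z, rfl⟩ := Submodule.Quotient.mk_surjective _ x
    exact (hker' z).mpr (hi z z.2 ((hker z).mp hx))

theorem injective_relCohomologyMap_iff (h : 𝔨 ≤ 𝔥) (p : ℕ) :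
    Function.Injective (relCohomologyMap h p) ↔
      ∀ α ∈ relCocycle 𝔥 p, α ∈ relCoboundary 𝔨 p → α ∈ relCoboundary 𝔥 p :=
  injective_subquotientMap_iff (relCocycle_mono h p) (relCoboundary_mono h p)

variable [FiniteDimensional ℝ 𝔤]

/-- For `𝔥` reductive in the unimodular Lie algebra `𝔤`, injectivity in top degree implies
injectivity below, by Poincaré duality. -/
theorem injective_relCohomologyMap_of_codim (hG : AdTraceFree 𝔤) (hred : IsReductiveIn 𝔥)
    (h : 𝔨 ≤ 𝔥) (hinj : Function.Injective (relCohomologyMap h (codim 𝔥))) {p : ℕ}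
    (hp : p < codim 𝔥) : Function.Injective (relCohomologyMap h p) := by
  obtain ⟨F, hT⟩ := hred.exists_dualFrame hG
  generalize codim 𝔥 = N at F hinj hp
  rw [injective_relCohomologyMap_iff] at hinj ⊢
  intro α hα hαk
  cases p with
  -- In degree zero both coboundary spaces are `⊥`.
  | zero => exact hαk
  | succ p =>
    obtain ⟨η, hη, rfl⟩ := hαk
    by_contra hne
    obtain ⟨n, rfl⟩ : ∃ n, N = n + 1 := ⟨N - 1, by omega⟩
    -- The degree of `α` is now `p + 1`, that of `η` is `p`, and `q = N - (p + 1)` is the degree of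
    -- the dual cochain.
    obtain ⟨q, rfl⟩ : ∃ q, n = p + q := ⟨n - p, by omega⟩
    let E₀ : Fin p ⊕ Fin q ≃ Fin (p + q) := finSumFinEquiv
    let E₁ : Fin (p + 1) ⊕ Fin q ≃ Fin (p + q + 1) :=
      finSumFinEquiv.trans (finCongr (by omega))
    let E₂ : Fin p ⊕ Fin (q + 1) ≃ Fin (p + q + 1) := finSumFinEquiv
    let E₃ : Fin (p + 2) ⊕ Fin q ≃ Fin (p + q + 2) :=
      finSumFinEquiv.trans (finCongr (by omega))
    let E₄ : Fin (p + 1) ⊕ Fin (q + 1) ≃ Fin (p + q + 2) :=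
      finSumFinEquiv.trans (finCongr (by omega))
    obtain ⟨a, b, ha, hb, hLeib⟩ := exists_ceDiff_wedge (𝔤 := 𝔤) E₀ E₁ E₂
    obtain ⟨a', b', -, -, hLeib'⟩ := exists_ceDiff_wedge (𝔤 := 𝔤) E₁ E₃ E₄
    obtain ⟨φ, hφ, hker⟩ := Submodule.exists_le_ker_of_notMem hne
    obtain ⟨β, hβ, hpair⟩ := F.exists_wedge_eq hT hred E₁ φ
    -- For every relative `γ` of degree `p`, `0 = d(γ ∧ β)` and `dγ ∧ β` pairs to `φ (dγ) = 0`, so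
    -- `γ ∧ dβ = 0`; nondegeneracy then gives `dβ = 0`.
    have hdβ : ceDiff q β = 0 := by
      by_contra h0
      obtain ⟨γ, hγ, hγne⟩ := F.exists_relCochain_wedge_ne_zero hT hred
        ((Equiv.sumComm (Fin (q + 1)) (Fin p)).trans E₂) (ceDiff_mem_relCochain hβ) h0
      rw [← wedge_comm] at hγne
      have h1 := AlternatingMap.congr_fun (hLeib γ β) F.e
      rw [DualFrame.ceDiff_eq_zero F hT (wedge_mem_relCochain E₀ hγ hβ), AlternatingMap.add_apply,
        AlternatingMap.smul_apply, hpair _ (ceDiff_mem_relCochain hγ),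
        show φ (ceDiff p γ) = 0 from hker (Submodule.mem_map_of_mem hγ), smul_zero, zero_add,
        AlternatingMap.smul_apply, AlternatingMap.zero_apply, eq_comm, smul_eq_zero,
        or_iff_right hb] at h1
      exact hγne h1
    have hzero : ∀ {p q n : ℕ} (e : Fin p ⊕ Fin q ≃ Fin n) (γ : 𝔤 [⋀^Fin p]→ₗ[ℝ] ℝ),
        wedge e γ (0 : 𝔤 [⋀^Fin q]→ₗ[ℝ] ℝ) = 0 := fun e γ => (wedgeLM e γ).map_zero
    have hcocycle : wedge E₁ (ceDiff p η) β ∈ relCocycle 𝔥 (p + q + 1) := by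
      refine ⟨wedge_mem_relCochain E₁ hα.1 hβ, ?_⟩
      refine LinearMap.mem_ker.mpr ?_
      rw [hLeib', hdβ, LinearMap.mem_ker.mp hα.2, hzero, wedge_comm, hzero]
      simp
    -- Since `dβ = 0`, the Leibniz rule reads `d(η ∧ β) = a • (dη ∧ β)`, whence the factor `a⁻¹`.
    have hcob : wedge E₁ (ceDiff p η) β ∈ relCoboundary 𝔨 (p + q + 1) := by
      refine ⟨a⁻¹ • wedge E₀ η β, Submodule.smul_mem _ _
        (wedge_mem_relCochain E₀ hη (relCochain_mono h q hβ)), ?_⟩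
      rw [map_smul, hLeib, hdβ, hzero, smul_zero, add_zero, smul_smul, inv_mul_cancel₀ ha, one_smul]
    obtain ⟨θ, hθ, hθeq⟩ := hinj _ hcocycle hcob
    rw [DualFrame.ceDiff_eq_zero F hT hθ] at hθeq
    refine hφ ?_
    rw [← hpair _ hα.1, ← hθeq]
    rfl

end Duality
end RelLie

/-! ### The statement for Lie groups -/

theorem proposition5p1
    {E : Type*} [NormedAddCommGroup E] [NormedSpace ℝ E] [FiniteDimensional ℝ E]
    {G : Type*} [TopologicalSpace G] [ChartedSpace E G] [Group G] [LieGroup 𝓘(ℝ, E) ∞ G]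
    (hG : RelLie.AdTraceFree (GroupLieAlgebra 𝓘(ℝ, E) G))
    (H : Subgroup G) (hH : IsClosed (H : Set G))
    (hred : RelLie.IsReductiveIn
      (RelLie.lieAlgebraOf H : LieSubalgebra ℝ (GroupLieAlgebra 𝓘(ℝ, E) G)))
    (K : Subgroup G) (hK : RelLie.IsMaximalCompactIn K H)
    (N : ℕ) (hN : N = RelLie.codim
      (RelLie.lieAlgebraOf H : LieSubalgebra ℝ (GroupLieAlgebra 𝓘(ℝ, E) G)))
    (hinj : Function.Injective
      (RelLie.relCohomologyMap (RelLie.lieAlgebraOf_mono (E := E) hK.le) N)) :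
    ∀ p : ℕ, p < N → Function.Injective
      (RelLie.relCohomologyMap (RelLie.lieAlgebraOf_mono (E := E) hK.le) p) := by
  intro p hp
  subst hN
  have : FiniteDimensional ℝ (GroupLieAlgebra 𝓘(ℝ, E) G) := inferInstanceAs (FiniteDimensional ℝ E)
  exact RelLie.injective_relCohomologyMap_of_codim hG hred _ hinj hp
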